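/- Theorem. Let $X$ be a compact well-ordered space, i.e. a well-ordered set whose order topology is compact. Let $X^{(0)}=X$, let $X^{(\alpha+1)}$ be the set of accumulation points of the space $X^{(\alpha)}$, and let $X^{(\lambda)}=\bigcap_{\alpha<\lambda}X^{(\alpha)}$ for limit ordinals $\lambda$. The Cantor--Bendixson rank of $X$ is the least ordinal $\alpha$ with $X^{(\alpha+1)}=X^{(\alpha)}$; it is a successor ordinal when $X\neq\varnothing$, and its predecessor is called the limit capacity of $X$. If $X$ is nonempty and its limit capacity is a successor ordinal, then the homeomorphism group $\mathrm{Homeo}(X)$ is SB-generated: it is generated by a subset $S\subseteq\mathrm{Homeo}(X)$ that is strongly bounded, meaning that $S$ has finite diameter in every left-invariant metric on the (abstract) group $\mathrm{Homeo}(X)$. -/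

import Mathlib

/-- A subset `A` of a group `G` is strongly bounded if it has finite diameter in every
left-invariant metric on `G`. -/
def StronglyBounded {G : Type*} [Group G] (A : Set G) : Prop :=
  ∀ m : MetricSpace G, (∀ g x y : G, m.dist (g * x) (g * y) = m.dist x y) →
    ∃ C : ℝ, ∀ x ∈ A, ∀ y ∈ A, m.dist x y ≤ C

/-- A group is SB-generated if it is generated by a strongly bounded subset. -/
def SBGenerated (G : Type*) [Group G] : Prop :=
  ∃ S : Set G, StronglyBounded S ∧ Subgroup.closure S = ⊤

/-- The Cantor–Bendixson rank of a space: the least ordinal `a` such that the `a`-th and the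
`(a + 1)`-st Cantor–Bendixson derivatives coincide. (The derivatives are Mathlib's: at each
successor stage one keeps the accumulation points of the previous derivative lying in it, and
intersections are taken at limit stages.) -/
noncomputable def cantorBendixsonRank (X : Type*) [TopologicalSpace X] : Ordinal :=
  sInf {a | CantorBendixson.iteratedDerivedSet (Set.univ : Set X) (a + 1) =
    CantorBendixson.iteratedDerivedSet (Set.univ : Set X) a}

/-- The limit capacity: the predecessor of the Cantor–Bendixson rank. For a nonempty compact
well-ordered space the rank is a successor ordinal; where the rank is not a successor (as for the
empty space, of rank `0`) the value is the rank itself, which is again not a successor. -/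
noncomputable def limitCapacity (X : Type*) [TopologicalSpace X] : Ordinal :=
  Ordinal.pred (cantorBendixsonRank X)

/-! If the limit capacity is `b + 1`, the last nonempty derivative P = X^(b+1) is finite: X^(b+2) is
dense in itself, hence empty, and compactness does the rest. A continuous retraction onto P cuts X
into clopen fibres F_p, each with p as its only point of X^(b+1).

The classification behind everything: compact well-ordered spaces whose a-th derivative is a single
point are homeomorphic (`nonempty_homeomorph_of_cbDerivative_eq_singleton`). After reordering so
that this point is last, compare the two well-orders by an initial segment embedding.

Boundedness. F_p without p is a countable sum of compact pieces, each with one point of rank b,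
hence pairwise homeomorphic. This makes it self-similar, and a diagonal argument with a commutator
swindle, followed by a fragmentation argument, bounds every length function on its homeomorphism
group (`IsSelfSimilarFor.lengthBounded_univ`). Homeomorphisms of F_p fix p, so the bound passes to
F_p and to the homeomorphisms of X supported there.

Generation. To these subgroups add finitely many swaps of fibres and, for each p other than a base
point p₀, a shift pushing a piece with one rank-b point from F_p into F_{p₀}. Modulo swaps, g fixes
P pointwise. The points that change fibre then form a clopen set missing P, with finitely many
rank-b points. Pushing this set and its image into F_{p₀} by shifts turns g into a map preserving
every fibre (`mem_of_fixes_cbDerivative`). -/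

open Set Topology
open scoped Filter

universe u

/-! ### Gluing homeomorphisms along open partitions -/

/-- The disjoint union of two disjoint open sets. -/
noncomputable def sumUnionHomeomorph {X : Type*} [TopologicalSpace X] {U V : Set X}
    (hU : IsOpen U) (hV : IsOpen V) (h : Disjoint U V) : U ⊕ V ≃ₜ ↥(U ∪ V) := by
  classical
  refine (Equiv.Set.union h).symm.toHomeomorphOfContinuousOpen ?_ ?_
  · refine continuous_sum_dom.2 ⟨?_, ?_⟩
    · exact Continuous.subtype_mk continuous_subtype_val _
    · exact Continuous.subtype_mk continuous_subtype_val _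
  · refine isOpenMap_sum.2 ⟨?_, ?_⟩
    · exact (hU.isOpenMap_subtype_val).subtype_mk _
    · exact (hV.isOpenMap_subtype_val).subtype_mk _

/-- Two homeomorphisms between disjoint open sets combine to one between their unions. -/
theorem exists_homeomorph_union {X Y : Type*} [TopologicalSpace X] [TopologicalSpace Y]
    {U V : Set X} {U' V' : Set Y} (hU : IsOpen U) (hV : IsOpen V) (h : Disjoint U V)
    (hU' : IsOpen U') (hV' : IsOpen V') (h' : Disjoint U' V') (e : U ≃ₜ U') (f : V ≃ₜ V') :
    ∃ t : ↥(U ∪ V) ≃ₜ ↥(U' ∪ V'), (∀ x : U, (t ⟨x, Or.inl x.2⟩ : Y) = e x) ∧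
      ∀ x : V, (t ⟨x, Or.inr x.2⟩ : Y) = f x := by
  refine ⟨((sumUnionHomeomorph hU hV h).symm.trans (e.sumCongr f)).trans
    (sumUnionHomeomorph hU' hV' h'), fun x => ?_, fun x => ?_⟩
  · have : (sumUnionHomeomorph hU hV h).symm ⟨x, Or.inl x.2⟩ = Sum.inl x := by
      rw [Homeomorph.symm_apply_eq]; rfl
    simp only [Homeomorph.trans_apply, this]
    rfl
  · have : (sumUnionHomeomorph hU hV h).symm ⟨x, Or.inr x.2⟩ = Sum.inr x := by
      rw [Homeomorph.symm_apply_eq]; rfl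
    simp only [Homeomorph.trans_apply, this]
    rfl

/-- Two homeomorphisms between complementary clopen sets combine to a homeomorphism. -/
theorem exists_homeomorph_glue {X Y : Type*} [TopologicalSpace X] [TopologicalSpace Y]
    {U : Set X} {V : Set Y} (hU : IsClopen U) (hV : IsClopen V) (e : U ≃ₜ V)
    (f : ↥Uᶜ ≃ₜ ↥Vᶜ) :
    ∃ t : X ≃ₜ Y, (∀ x : U, t x = e x) ∧ ∀ x : ↥Uᶜ, t x = f x := by
  obtain ⟨t, h1, h2⟩ := exists_homeomorph_union hU.isOpen hU.compl.isOpen disjoint_compl_right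
    hV.isOpen hV.compl.isOpen disjoint_compl_right e f
  refine ⟨(((Homeomorph.Set.univ X).symm.trans (Homeomorph.setCongr (union_compl_self U).symm)).trans
    t).trans ((Homeomorph.setCongr (union_compl_self V)).trans (Homeomorph.Set.univ Y)), ?_, ?_⟩
  · exact h1
  · exact h2

/-- A homeomorphism between clopen subsets of a clopen set `D` with homeomorphic complements in `D`
extends to a homeomorphism that is the identity off `D`. -/
theorem exists_homeomorph_supported {X : Type*} [TopologicalSpace X] {D A B : Set X}
    (hD : IsClopen D) (hA : IsClopen A) (hB : IsClopen B) (hAD : A ⊆ D) (hBD : B ⊆ D)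
    (e : A ≃ₜ B) (f : ↥(D \ A) ≃ₜ ↥(D \ B)) :
    ∃ t : X ≃ₜ X, (∀ x : A, t x = e x) ∧ (∀ x : ↥(D \ A), t x = f x) ∧ ∀ x ∉ D, t x = x := by
  have key : ∀ {A : Set X}, A ⊆ D → (D \ A) ∪ Dᶜ = Aᶜ := by
    intro A hA
    ext x
    simp only [mem_union, mem_sdiff, mem_compl_iff]
    have := @hA x
    tauto
  have dj : ∀ A : Set X, Disjoint (D \ A) Dᶜ := fun A =>
    disjoint_compl_right.mono_left sdiff_subset
  obtain ⟨s, h1, h2⟩ := exists_homeomorph_union (hD.diff hA).isOpen hD.compl.isOpen (dj A)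
    (hD.diff hB).isOpen hD.compl.isOpen (dj B) f (Homeomorph.refl _)
  obtain ⟨t, h3, h4⟩ := exists_homeomorph_glue hA hB e
    (((Homeomorph.setCongr (key hAD)).symm.trans s).trans (Homeomorph.setCongr (key hBD)))
  refine ⟨t, h3, fun x => ?_, fun x hx => ?_⟩
  · exact (h4 ⟨x, x.2.2⟩).trans (h1 x)
  · exact (h4 ⟨x, fun h => hx (hAD h)⟩).trans (h2 ⟨x, hx⟩)

/-- A space is a product if the fibres of a continuous map to a discrete space are all
homeomorphic. -/
theorem exists_homeomorph_prod_of_fibers {X ι T : Type*} [TopologicalSpace X]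
    [TopologicalSpace ι] [DiscreteTopology ι] [TopologicalSpace T] {c : X → ι} (hc : Continuous c)
    (e : ∀ i, ↥(c ⁻¹' {i}) ≃ₜ T) : ∃ E : X ≃ₜ ι × T, ∀ x, (E x).1 = c x := by
  let E : ι × T ≃ X :=
    { toFun := fun y => ((e y.1).symm y.2 : X)
      invFun := fun x => (c x, e (c x) ⟨x, rfl⟩)
      left_inv := by
        rintro ⟨i, y⟩
        have hi : c ((e i).symm y : X) = i := ((e i).symm y).2
        have key : ∀ j (h : c ((e i).symm y : X) = j), j = i →
            ((j, e j ⟨((e i).symm y : X), h⟩) : ι × T) = (i, y) := by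
          rintro j h rfl
          exact Prod.ext rfl ((e j).apply_symm_apply y)
        exact key _ rfl hi
      right_inv := fun x => by simp }
  have h1 : Continuous E := by
    refine continuous_prod_of_discrete_left.2 fun i => ?_
    exact continuous_subtype_val.comp (e i).symm.continuous
  have h2 : IsOpenMap E := by
    intro W hW
    have : E '' W = ⋃ i, Subtype.val '' ((e i).symm '' {y | (i, y) ∈ W}) := by
      ext x
      simp only [mem_image, Prod.exists, mem_iUnion]
      constructor
      · rintro ⟨i, y, h, rfl⟩
        exact ⟨i, _, ⟨y, h, rfl⟩, rfl⟩
      · rintro ⟨i, _, ⟨y, h, rfl⟩, rfl⟩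
        exact ⟨i, y, h, rfl⟩
    rw [this]
    refine isOpen_iUnion fun i => ?_
    refine ((isOpen_discrete {i}).preimage hc).isOpenMap_subtype_val _ ?_
    refine (e i).symm.isOpenMap _ ?_
    exact hW.preimage (by fun_prop)
  exact ⟨(E.toHomeomorphOfContinuousOpen h1 h2).symm, fun _ => rfl⟩

/-- The homeomorphism of `ι × T` acting on the slice over `i` by `f i`. -/
def sliceHomeomorph {ι T : Type*} [TopologicalSpace ι] [DiscreteTopology ι] [TopologicalSpace T]
    (f : ι → T ≃ₜ T) : ι × T ≃ₜ ι × T where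
  toFun y := (y.1, f y.1 y.2)
  invFun y := (y.1, (f y.1).symm y.2)
  left_inv y := by simp
  right_inv y := by simp
  continuous_toFun := continuous_prod_of_discrete_left.2 fun i => by
    simp only; fun_prop
  continuous_invFun := continuous_prod_of_discrete_left.2 fun i => by
    simp only; fun_prop

@[simp]
theorem sliceHomeomorph_apply {ι T : Type*} [TopologicalSpace ι] [DiscreteTopology ι]
    [TopologicalSpace T] (f : ι → T ≃ₜ T) (i : ι) (y : T) :
    sliceHomeomorph f (i, y) = (i, f i y) := rfl

/-! ### Length functions -/

/-- A symmetric subadditive function on a group. -/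
structure IsLengthFunction {G : Type*} [Group G] (L : G → ℝ) : Prop where
  mul_le : ∀ g h, L (g * h) ≤ L g + L h
  inv_eq : ∀ g, L g⁻¹ = L g

/-- A subset of a group on which every length function is bounded. -/
def LengthBounded {G : Type*} [Group G] (A : Set G) : Prop :=
  ∀ L : G → ℝ, IsLengthFunction L → ∃ C : ℝ, ∀ g ∈ A, L g ≤ C

theorem IsLengthFunction.comp {G H : Type*} [Group G] [Group H] {L : G → ℝ}
    (hL : IsLengthFunction L) (f : H →* G) : IsLengthFunction (L ∘ f) :=
  ⟨fun g h => by simpa using hL.mul_le (f g) (f h), fun g => by simpa using hL.inv_eq (f g)⟩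

/-- The distance to 1 is a length function, and the triangle inequality through 1 bounds the
diameter. Length functions pull back along every homomorphism, whereas a metric may lose separation.
-/
theorem LengthBounded.stronglyBounded {G : Type*} [Group G] {A : Set G} (hA : LengthBounded A) :
    StronglyBounded A := by
  intro m hm
  have hL : IsLengthFunction (fun g : G => m.dist 1 g) := by
    refine ⟨fun g h => ?_, fun g => ?_⟩
    · calc m.dist 1 (g * h) ≤ m.dist 1 g + m.dist g (g * h) := m.dist_triangle _ _ _
        _ = m.dist 1 g + m.dist 1 h := by
          have := hm g 1 h
          rw [mul_one] at this
          rw [this]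
    · have := hm g 1 g⁻¹
      rw [mul_one, mul_inv_cancel] at this
      rw [← this, m.dist_comm]
  obtain ⟨C, hC⟩ := hA _ hL
  refine ⟨C + C, fun x hx y hy => (m.dist_triangle x 1 y).trans (add_le_add ?_ (hC y hy))⟩
  rw [m.dist_comm]
  exact hC x hx

theorem LengthBounded.image {G H : Type*} [Group G] [Group H] {A : Set H} (hA : LengthBounded A)
    (f : H →* G) : LengthBounded (f '' A) := by
  intro L hL
  obtain ⟨C, hC⟩ := hA _ (hL.comp f)
  refine ⟨C, ?_⟩
  rintro _ ⟨g, hg, rfl⟩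
  exact hC g hg

theorem LengthBounded.union {G : Type*} [Group G] {A B : Set G} (hA : LengthBounded A)
    (hB : LengthBounded B) : LengthBounded (A ∪ B) := by
  intro L hL
  obtain ⟨C, hC⟩ := hA L hL
  obtain ⟨D, hD⟩ := hB L hL
  refine ⟨max C D, ?_⟩
  rintro g (hg | hg)
  · exact (hC g hg).trans (le_max_left _ _)
  · exact (hD g hg).trans (le_max_right _ _)

theorem LengthBounded.iUnion {G ι : Type*} [Group G] [Finite ι] {A : ι → Set G}
    (hA : ∀ i, LengthBounded (A i)) : LengthBounded (⋃ i, A i) := by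
  intro L hL
  choose C hC using fun i => hA i L hL
  obtain ⟨D, hD⟩ := (Set.finite_range C).bddAbove
  refine ⟨D, fun g hg => ?_⟩
  obtain ⟨i, hi⟩ := mem_iUnion.1 hg
  exact (hC i g hi).trans (hD ⟨i, rfl⟩)

theorem Set.Finite.lengthBounded {G : Type*} [Group G] {A : Set G} (hA : A.Finite) :
    LengthBounded A := by
  intro L _
  obtain ⟨D, hD⟩ := (hA.image L).bddAbove
  exact ⟨D, fun g hg => hD ⟨g, hg, rfl⟩⟩

/-! ### Homeomorphism groups of self-similar spaces are strongly bounded -/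

/-- Conjugation by a homeomorphism. -/
def conjHomeomorph {X Y : Type*} [TopologicalSpace X] [TopologicalSpace Y] (e : X ≃ₜ Y) :
    (X ≃ₜ X) →* (Y ≃ₜ Y) where
  toFun g := (e.symm.trans g).trans e
  map_one' := by ext x; simp
  map_mul' g h := by ext x; simp

@[simp]
theorem conjHomeomorph_apply {X Y : Type*} [TopologicalSpace X] [TopologicalSpace Y] (e : X ≃ₜ Y)
    (g : X ≃ₜ X) (y : Y) : conjHomeomorph e g y = e (g (e.symm y)) := rfl

/-- The homeomorphisms supported in `A`. -/
def supportedIn {X : Type*} [TopologicalSpace X] (A : Set X) : Subgroup (X ≃ₜ X) where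
  carrier := {g | ∀ x ∉ A, g x = x}
  one_mem' _ _ := rfl
  mul_mem' {g h} hg hh x hx := by
    rw [Homeomorph.mul_apply, hh x hx, hg x hx]
  inv_mem' {g} hg x hx := by
    conv_lhs => rw [← hg x hx]
    exact g.symm_apply_apply x

theorem supportedIn_apply_mem_iff {X : Type*} [TopologicalSpace X] {A : Set X} {g : X ≃ₜ X}
    (hg : g ∈ supportedIn A) {x : X} : g x ∈ A ↔ x ∈ A := by
  constructor
  · intro h
    by_contra hx
    exact hx (hg x hx ▸ h)
  · intro h
    by_contra hx
    have := g.injective (hg _ hx)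
    rw [this] at hx
    exact hx h

/-- Diagonal argument: if each slice n had an f n all of whose extensions have length above n, the
slicewise union of the f n would have infinite length. -/
theorem exists_nat_forall_exists_extension_le {T : Type*} [TopologicalSpace T]
    (L : (ℕ × T ≃ₜ ℕ × T) → ℝ) :
    ∃ n : ℕ, ∀ f : T ≃ₜ T, ∃ g : ℕ × T ≃ₜ ℕ × T, (∀ y, g (n, y) = (n, f y)) ∧ L g ≤ n := by
  by_contra! H
  choose f hf using H
  obtain ⟨n, hn⟩ := exists_nat_gt (L (sliceHomeomorph f))
  exact (hf n (sliceHomeomorph f) fun y => rfl).not_gt hn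

/-- Swindle: F is the commutator of the shift b of slice n with a map acting by f on all copies i ≥
0. The latter may be replaced by any g agreeing with it on slice n, since b is trivial elsewhere,
and such a g exists with length at most n. -/
theorem exists_bound_slice {T : Type*} [TopologicalSpace T]
    {L : (ℕ × (ℤ × T) ≃ₜ ℕ × (ℤ × T)) → ℝ} (hL : IsLengthFunction L) :
    ∃ (n : ℕ) (C : ℝ), ∀ F : ℕ × (ℤ × T) ≃ₜ ℕ × (ℤ × T), ∀ f : T ≃ₜ T,
      (∀ y, F (n, 0, y) = (n, 0, f y)) → (∀ m i y, (m ≠ n ∨ i ≠ 0) → F (m, i, y) = (m, i, y)) →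
      L F ≤ C := by
  obtain ⟨n, hn⟩ := exists_nat_forall_exists_extension_le L
  let s : ℤ × T ≃ₜ ℤ × T := (Homeomorph.addRight (1 : ℤ)).prodCongr (Homeomorph.refl T)
  let b : ℕ × (ℤ × T) ≃ₜ ℕ × (ℤ × T) := sliceHomeomorph fun m => if m = n then s else 1
  have hb : ∀ i y, b (n, i, y) = (n, i + 1, y) := fun i y => by simp [b, s]
  have hb' : ∀ m t, m ≠ n → b (m, t) = (m, t) := fun m t h => by simp [b, h]
  refine ⟨n, n + L b + n + L b, fun F f hF hF' => ?_⟩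
  let a : ℤ × T ≃ₜ ℤ × T := sliceHomeomorph fun i => if 0 ≤ i then f else 1
  obtain ⟨g, hg, hgL⟩ := hn a
  have ha : ∀ i y, 0 ≤ i → a (i, y) = (i, f y) := fun i y h => by simp [a, h]
  have ha' : ∀ i y, i < 0 → a (i, y) = (i, y) := fun i y h => by simp [a, not_le.2 h]
  -- The two sides differ only where `i < 0 ≤ i + 1`, and there F supplies the missing f.
  have key : F * b * g = g * b := by
    ext1 ⟨m, i, y⟩
    simp only [Homeomorph.mul_apply]
    by_cases hm : m = n
    · subst hm
      rw [hg, hb i y, hg]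
      rcases lt_trichotomy (i + 1) 0 with hi | hi | hi
      · rw [ha' _ _ (by omega), hb, ha' _ _ hi, hF' _ _ _ (Or.inr hi.ne)]
      · rw [ha' _ _ (by omega), hb, hi, ha _ _ le_rfl, hF]
      · rw [ha _ _ (by omega), hb, ha _ _ hi.le, hF' _ _ _ (Or.inr hi.ne')]
    · have h1 : (g (m, i, y)).1 ≠ n := by
        intro h
        have h2 : g (n, a.symm (g (m, i, y)).2) = g (m, i, y) := by
          rw [hg, a.apply_symm_apply]
          exact Prod.ext h.symm rfl
        exact hm (congrArg Prod.fst (g.injective h2)).symm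
      rw [hb' _ _ hm]
      generalize g (m, i, y) = z at h1 ⊢
      obtain ⟨m', i', y'⟩ := z
      rw [hb' _ _ h1, hF' _ _ _ (Or.inl h1)]
  have hF2 : F = g * b * g⁻¹ * b⁻¹ := by
    rw [← key]; group
  have e1 := hL.mul_le (g * b * g⁻¹) b⁻¹
  have e2 := hL.mul_le (g * b) g⁻¹
  have e3 := hL.mul_le g b
  rw [hL.inv_eq] at e1 e2
  rw [hF2]
  linarith

/-- If `X` is homeomorphic to a disjoint union of copies of itself indexed by `ℕ × ℤ`, then the
homeomorphisms supported in one of the copies have bounded length. -/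
theorem exists_bound_supportedIn {X : Type*} [TopologicalSpace X]
    (e : X ≃ₜ ℕ × (ℤ × X)) {L : (X ≃ₜ X) → ℝ} (hL : IsLengthFunction L) :
    ∃ (n : ℕ) (C : ℝ), ∀ g ∈ supportedIn (e ⁻¹' {y | y.1 = n ∧ y.2.1 = 0}), L g ≤ C := by
  obtain ⟨n, C, hC⟩ := exists_bound_slice (hL.comp (conjHomeomorph e.symm))
  refine ⟨n, C, fun g hg => ?_⟩
  set A := e ⁻¹' {y : ℕ × (ℤ × X) | y.1 = n ∧ y.2.1 = 0} with hA
  have mem : ∀ y, e.symm (n, 0, y) ∈ A := fun y => by simp [hA]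
  have key : ∀ g ∈ supportedIn A, ∀ y,
      conjHomeomorph e g (n, 0, y) = (n, 0, (conjHomeomorph e g (n, 0, y)).2.2) := by
    intro g hg y
    have h := (supportedIn_apply_mem_iff hg).2 (mem y)
    simp only [hA, mem_preimage, mem_ofPred_eq] at h
    refine Prod.ext h.1 (Prod.ext h.2 rfl)
  have inv : ∀ g ∈ supportedIn A, ∀ y, (conjHomeomorph e g⁻¹
      (n, 0, (conjHomeomorph e g (n, 0, y)).2.2)).2.2 = y := by
    intro g hg y
    rw [← key g hg, ← Homeomorph.mul_apply, ← map_mul, inv_mul_cancel, map_one]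
    rfl
  let f : X ≃ₜ X :=
    { toFun := fun y => (conjHomeomorph e g (n, 0, y)).2.2
      invFun := fun y => (conjHomeomorph e g⁻¹ (n, 0, y)).2.2
      left_inv := inv g hg
      right_inv := fun y => by
        have := inv g⁻¹ (inv_mem hg) y
        rwa [inv_inv] at this
      continuous_toFun := by fun_prop
      continuous_invFun := by fun_prop }
  have hgl : (L ∘ conjHomeomorph e.symm) (conjHomeomorph e g) = L g := by
    have : conjHomeomorph e.symm (conjHomeomorph e g) = g := by ext x; simp
    simp [this]
  rw [← hgl]
  refine hC _ f (key g hg) fun m i y hmi => ?_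
  have : e.symm (m, i, y) ∉ A := by
    simp only [hA, mem_preimage, mem_ofPred_eq, Homeomorph.apply_symm_apply]
    tauto
  rw [conjHomeomorph_apply, hg _ this, Homeomorph.apply_symm_apply]


/-- A set of points invariant under homeomorphisms, such that clopen sets with infinitely many of
these points are pairwise homeomorphic and can be split into infinitely many such sets. -/
structure IsSelfSimilarFor {X : Type*} [TopologicalSpace X] (M : Set X) : Prop where
  apply_mem_iff : ∀ (g : X ≃ₜ X) (x : X), g x ∈ M ↔ x ∈ M
  infinite : M.Infinite
  nonempty_homeomorph : ∀ U V : Set X, IsClopen U → IsClopen V → (U ∩ M).Infinite →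
    (V ∩ M).Infinite → Nonempty (U ≃ₜ V)
  exists_split : ∀ U : Set X, IsClopen U → (U ∩ M).Infinite →
    ∃ c : X → ℕ, Continuous c ∧ ∀ n, (U ∩ c ⁻¹' {n} ∩ M).Infinite

namespace IsSelfSimilarFor

variable {X : Type*} [TopologicalSpace X] {M : Set X}

theorem exists_clopen_bound (hM : IsSelfSimilarFor M) {L : (X ≃ₜ X) → ℝ}
    (hL : IsLengthFunction L) :
    ∃ A : Set X, IsClopen A ∧ (A ∩ M).Infinite ∧ (Aᶜ ∩ M).Infinite ∧
      ∃ C, ∀ g ∈ supportedIn A, L g ≤ C := by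
  obtain ⟨c, hc, hcM⟩ := hM.exists_split univ isClopen_univ (by simpa using hM.infinite)
  simp only [univ_inter] at hcM
  let d : X → ℕ × ℤ := fun x => (Denumerable.eqv (ℕ × ℤ)).symm (c x)
  have hd : Continuous d := continuous_of_discreteTopology.comp hc
  have hdc : ∀ i, d ⁻¹' {i} = c ⁻¹' {Denumerable.eqv (ℕ × ℤ) i} := by
    intro i
    ext x
    simp [d, Equiv.symm_apply_eq]
  have hdM : ∀ i, (d ⁻¹' {i} ∩ M).Infinite := fun i => by rw [hdc]; exact hcM _
  have hcl : ∀ i, IsClopen (d ⁻¹' {i}) := fun i => (isClopen_discrete {i}).preimage hd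
  have e : ∀ i, Nonempty (↥(d ⁻¹' {i}) ≃ₜ X) := fun i =>
    (hM.nonempty_homeomorph _ univ (hcl i) isClopen_univ (hdM i)
      (by simpa using hM.infinite)).map fun e => e.trans (Homeomorph.Set.univ X)
  obtain ⟨E, hE⟩ := exists_homeomorph_prod_of_fibers hd fun i => (e i).some
  obtain ⟨n, C, hC⟩ := exists_bound_supportedIn (E.trans (Homeomorph.prodAssoc _ _ _)) hL
  refine ⟨d ⁻¹' {(n, 0)}, hcl _, hdM _, (hdM (n, 1)).mono ?_, C, ?_⟩
  · rintro x ⟨hx, hx'⟩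
    refine ⟨fun h => ?_, hx'⟩
    simp only [mem_preimage, mem_singleton_iff] at h hx
    rw [h] at hx
    simp at hx
  · convert hC using 4
    ext x
    simp only [← hE, Prod.ext_iff, mem_preimage, mem_singleton_iff]
    exact Iff.rfl

/-- Some homeomorphism t carries A onto the set B already controlled; conjugating by it costs 2 L t,
whatever g is. -/
theorem exists_bound_of_clopen (hM : IsSelfSimilarFor M) {L : (X ≃ₜ X) → ℝ}
    (hL : IsLengthFunction L) {A : Set X} (hA : IsClopen A) (hAM : (A ∩ M).Infinite)
    (hAM' : (Aᶜ ∩ M).Infinite) : ∃ C, ∀ g ∈ supportedIn A, L g ≤ C := by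
  obtain ⟨B, hB, hBM, hBM', C, hC⟩ := hM.exists_clopen_bound hL
  obtain ⟨e⟩ := hM.nonempty_homeomorph A B hA hB hAM hBM
  obtain ⟨f⟩ := hM.nonempty_homeomorph Aᶜ Bᶜ hA.compl hB.compl hAM' hBM'
  obtain ⟨t, ht, -⟩ := exists_homeomorph_glue hA hB e f
  refine ⟨L t + C + L t, fun g hg => ?_⟩
  have key : t * g * t⁻¹ ∈ supportedIn B := by
    intro x hx
    have : t⁻¹ x ∉ A := by
      intro h
      apply hx
      have h1 := ht ⟨_, h⟩
      rw [show t (t⁻¹ x) = x from t.apply_symm_apply x] at h1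
      rw [h1]
      exact (e _).2
    rw [Homeomorph.mul_apply, Homeomorph.mul_apply, hg _ this]
    exact t.apply_symm_apply x
  have e1 := hC _ key
  have e2 := hL.mul_le (t⁻¹ * (t * g * t⁻¹)) t
  have e3 := hL.mul_le t⁻¹ (t * g * t⁻¹)
  rw [hL.inv_eq] at e3
  rw [show t⁻¹ * (t * g * t⁻¹) * t = g by group] at e2
  linarith

/-- A homeomorphism moving much of `A` into `A ∪ B` is a product of four homeomorphisms supported
in `A ∪ B` or in the complement of `A`. -/
theorem le_of_infinite (hM : IsSelfSimilarFor M) {L : (X ≃ₜ X) → ℝ}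
    (hL : IsLengthFunction L) {A B : Set X} (hA : IsClopen A) (hB : IsClopen B)
    (hAB : Disjoint A B) (hAM : (A ∩ M).Infinite) (hBM : (B ∩ M).Infinite) {C C' : ℝ}
    (hC : ∀ g ∈ supportedIn (A ∪ B), L g ≤ C) (hC' : ∀ g ∈ supportedIn Aᶜ, L g ≤ C')
    (g : X ≃ₜ X) (hg : (g.symm ⁻¹' A ∩ (A ∪ B) ∩ M).Infinite) : L g ≤ 3 * C + C' := by
  have hD : IsClopen (A ∪ B) := hA.union hB
  set V := g.symm ⁻¹' A ∩ (A ∪ B) with hV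
  have hVc : IsClopen V := (hA.preimage g.symm.continuous).inter hD
  -- Only a part V₁ of g(A) ∩ (A ∪ B) is used, so that A ∪ B keeps infinitely many points of M
  -- outside it.
  obtain ⟨c, hc, hcM⟩ := hM.exists_split V hVc hg
  set V₁ := V ∩ c ⁻¹' {0} with hV₁
  have hV₁c : IsClopen V₁ := hVc.inter ((isClopen_discrete _).preimage hc)
  have hV₁D : V₁ ⊆ A ∪ B := fun x hx => hx.1.2
  set A' := g ⁻¹' V₁ with hA'
  have hA'c : IsClopen A' := hV₁c.preimage g.continuous
  have hA'A : A' ⊆ A := fun x hx => by simpa using hx.1.1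
  have hA'D : A' ⊆ A ∪ B := hA'A.trans subset_union_left
  have hA'M : (A' ∩ M).Infinite := by
    refine ((hcM 0).image (g.symm.injective.injOn)).mono ?_
    rintro _ ⟨x, ⟨hx, hxM⟩, rfl⟩
    refine ⟨?_, ?_⟩
    · rwa [hA', mem_preimage, g.apply_symm_apply]
    · rwa [hM.apply_mem_iff]
  have hdiff₁ : ((A ∪ B) \ V₁ ∩ M).Infinite := by
    refine (hcM 1).mono ?_
    rintro x ⟨⟨hx, hx1⟩, hxM⟩
    refine ⟨⟨hx.2, fun h => ?_⟩, hxM⟩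
    have := h.2
    simp_all
  have hdiff₂ : ((A ∪ B) \ A' ∩ M).Infinite := by
    refine hBM.mono ?_
    rintro x ⟨hx, hxM⟩
    exact ⟨⟨Or.inr hx, fun h => hAB.le_bot ⟨hA'A h, hx⟩⟩, hxM⟩
  have hdiff₃ : ((A ∪ B) \ A ∩ M).Infinite := by
    refine hBM.mono ?_
    rintro x ⟨hx, hxM⟩
    exact ⟨⟨Or.inr hx, fun h => hAB.le_bot ⟨h, hx⟩⟩, hxM⟩
  let e : V₁ ≃ₜ A' := g.symm.subtype (fun x => by simp [hA'])
  obtain ⟨f⟩ := hM.nonempty_homeomorph _ _ (hD.diff hV₁c) (hD.diff hA'c) hdiff₁ hdiff₂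
  obtain ⟨u, hu, -, hu'⟩ := exists_homeomorph_supported hD hV₁c hA'c hV₁D hA'D e f
  obtain ⟨e₂⟩ := hM.nonempty_homeomorph _ _ hA'c hA hA'M hAM
  obtain ⟨f₂⟩ := hM.nonempty_homeomorph _ _ (hD.diff hA'c) (hD.diff hA) hdiff₂ hdiff₃
  obtain ⟨v, hv, hv2, hv'⟩ := exists_homeomorph_supported hD hA'c hA hA'D subset_union_left e₂ f₂
  -- u undoes g on V₁, so u g fixes A' pointwise; v enlarges A' to A, so the conjugate fixes A
  -- pointwise. Solving for g uses u once and v twice, hence 3 * C + C'.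
  have key : v * (u * g) * v⁻¹ ∈ supportedIn Aᶜ := by
    intro x hx
    rw [mem_compl_iff, not_not] at hx
    have h1 : v.symm x ∈ A' := by
      have : v (e₂.symm ⟨x, hx⟩) = (⟨x, hx⟩ : A) := by
        rw [hv, e₂.apply_symm_apply]
      rw [show x = v (e₂.symm ⟨x, hx⟩) from this.symm, v.symm_apply_apply]
      exact (e₂.symm ⟨x, hx⟩).2
    have h2 : u (g (v.symm x)) = v.symm x := by
      rw [hu ⟨g (v.symm x), h1⟩]
      exact g.symm_apply_apply _
    change v (u (g (v.symm x))) = x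
    rw [h2, v.apply_symm_apply]
  have e0 := hC' _ key
  have e1 := hC u hu'
  have e2 := hC v hv'
  have e3 := hL.mul_le u⁻¹ (v⁻¹ * (v * (u * g) * v⁻¹) * v)
  have e4 := hL.mul_le (v⁻¹ * (v * (u * g) * v⁻¹)) v
  have e5 := hL.mul_le v⁻¹ (v * (u * g) * v⁻¹)
  rw [hL.inv_eq] at e3 e5
  rw [show u⁻¹ * (v⁻¹ * (v * (u * g) * v⁻¹) * v) = g by group] at e3
  linarith

/-- Take A to be the piece 0 and split the rest into two large parts. For any g, the infinitely many
points of M in g(A) meet the union of A with one of the parts infinitely often, and `le_of_infinite`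
applies to it. -/
theorem lengthBounded_univ (hM : IsSelfSimilarFor M) :
    LengthBounded (univ : Set (X ≃ₜ X)) := by
  intro L hL
  obtain ⟨c, hc, hcM⟩ := hM.exists_split univ isClopen_univ (by simpa using hM.infinite)
  simp only [univ_inter] at hcM
  have hcl : ∀ s : Set ℕ, IsClopen (c ⁻¹' s) := fun s => (isClopen_discrete s).preimage hc
  have big : ∀ (s : Set ℕ) (n : ℕ), n ∈ s → (c ⁻¹' s ∩ M).Infinite := fun s n hn =>
    (hcM n).mono (inter_subset_inter_left _ (preimage_mono (by simpa using hn)))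
  have bd : ∀ s : Set ℕ, s.Nonempty → sᶜ.Nonempty → ∃ C, ∀ g ∈ supportedIn (c ⁻¹' s), L g ≤ C := by
    rintro s ⟨n, hn⟩ ⟨m, hm⟩
    exact hM.exists_bound_of_clopen hL (hcl s) (big s n hn) (big sᶜ m hm)
  obtain ⟨C₁, hC₁⟩ := bd ({0} ∪ {1}) ⟨0, by simp⟩ ⟨2, by simp⟩
  obtain ⟨C₂, hC₂⟩ := bd ({0} ∪ {0, 1}ᶜ) ⟨0, by simp⟩ ⟨1, by simp⟩
  obtain ⟨C₃, hC₃⟩ := bd ({0}ᶜ) ⟨1, by simp⟩ ⟨0, by simp⟩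
  rw [preimage_union] at hC₁ hC₂
  rw [preimage_compl] at hC₃
  refine ⟨max (3 * C₁ + C₃) (3 * C₂ + C₃), fun g _ => ?_⟩
  have hcover : (g.symm ⁻¹' (c ⁻¹' {0}) ∩ M).Infinite := by
    refine ((hcM 0).image g.injective.injOn).mono ?_
    rintro _ ⟨x, ⟨hx, hxM⟩, rfl⟩
    exact ⟨by simpa using hx, by rwa [hM.apply_mem_iff]⟩
  have hdisj : ∀ s : Set ℕ, 0 ∉ s → Disjoint (c ⁻¹' {0}) (c ⁻¹' s) := fun s hs =>
    Disjoint.preimage _ (by simpa using hs)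
  have hsub : g.symm ⁻¹' (c ⁻¹' {0}) ∩ M ⊆
      (g.symm ⁻¹' (c ⁻¹' {0}) ∩ (c ⁻¹' {0} ∪ c ⁻¹' {1}) ∩ M) ∪
      (g.symm ⁻¹' (c ⁻¹' {0}) ∩ (c ⁻¹' {0} ∪ c ⁻¹' {0, 1}ᶜ) ∩ M) := by
    rintro x ⟨hx, hxM⟩
    by_cases h : c x = 1
    · exact Or.inl ⟨⟨hx, Or.inr h⟩, hxM⟩
    · refine Or.inr ⟨⟨hx, ?_⟩, hxM⟩
      by_cases h0 : c x = 0
      · exact Or.inl h0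
      · exact Or.inr (by simp [h, h0])
  rcases infinite_union.1 (hcover.mono hsub) with h | h
  · exact (hM.le_of_infinite hL (hcl _) (hcl _) (hdisj _ (by simp)) (hcM 0) (hcM 1)
      hC₁ hC₃ g h).trans (le_max_left _ _)
  · exact (hM.le_of_infinite hL (hcl _) (hcl _) (hdisj _ (by simp)) (hcM 0) (big _ 2 (by simp))
      hC₂ hC₃ g h).trans (le_max_right _ _)

end IsSelfSimilarFor

/-! ### Iterated derived sets -/

/-- The `a`-th Cantor–Bendixson derivative of a space. -/
def cbDerivative (X : Type u) [TopologicalSpace X] (a : Ordinal.{u}) : Set X :=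
  CantorBendixson.iteratedDerivedSet univ a

theorem isClosed_cbDerivative {X : Type u} [TopologicalSpace X] (a : Ordinal.{u}) :
    IsClosed (cbDerivative X a) :=
  CantorBendixson.isClosed_iteratedDerivedSet isClosed_univ a

theorem cbDerivative_succ {X : Type u} [TopologicalSpace X] (a : Ordinal.{u}) :
    cbDerivative X (a + 1) = relDerivedSet (cbDerivative X a) :=
  CantorBendixson.iteratedDerivedSet_succ

theorem mem_cbDerivative_succ {X : Type u} [TopologicalSpace X] {a : Ordinal.{u}} {x : X} :
    x ∈ cbDerivative X (a + 1) ↔ AccPt x (𝓟 (cbDerivative X a)) := by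
  rw [cbDerivative_succ, (isClosed_cbDerivative a).relDerivedSet_eq, mem_derivedSet]

theorem Topology.IsOpenEmbedding.preimage_relDerivedSet {X Y : Type u} [TopologicalSpace X]
    [TopologicalSpace Y] {f : X → Y} (hf : IsOpenEmbedding f) (S : Set Y) :
    f ⁻¹' relDerivedSet S = relDerivedSet (f ⁻¹' S) := by
  ext x
  simp only [relDerivedSet_apply, mem_preimage, mem_inter_iff, mem_derivedSet,
    accPt_iff_frequently, ← hf.map_nhds_eq, Filter.frequently_map, hf.injective.ne_iff]

/-- Accumulation is local, so derivatives restrict to open subspaces; in particular they are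
homeomorphism invariants. -/
theorem Topology.IsOpenEmbedding.preimage_cbDerivative {X Y : Type u}
    [TopologicalSpace X] [TopologicalSpace Y] {f : X → Y} (hf : IsOpenEmbedding f) (a : Ordinal) :
    f ⁻¹' cbDerivative _ a = cbDerivative _ a := by
  induction a using Ordinal.limitRecOn with
  | zero => simp [cbDerivative]
  | add_one a ih =>
    rw [cbDerivative_succ, cbDerivative_succ, hf.preimage_relDerivedSet, ih]
  | limit a ha ih =>
    simp only [cbDerivative] at ih ⊢
    rw [CantorBendixson.iteratedDerivedSet_limit ha, CantorBendixson.iteratedDerivedSet_limit ha,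
      preimage_iInter]
    exact iInter_congr fun b => ih b b.2

theorem Homeomorph.apply_mem_cbDerivative {X Y : Type u}
    [TopologicalSpace X] [TopologicalSpace Y] (f : X ≃ₜ Y) (a : Ordinal) (x : X) :
    f x ∈ cbDerivative _ a ↔
      x ∈ cbDerivative _ a := by
  rw [← f.isOpenEmbedding.preimage_cbDerivative a, mem_preimage]

theorem finite_cbDerivative_inter_of_isCompact {X : Type u} [TopologicalSpace X]
    {a : Ordinal} {K : Set X} (hK : IsCompact K)
    (h : Disjoint K (cbDerivative _ (a + 1))) :
    (cbDerivative _ a ∩ K).Finite := by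
  by_contra hinf
  obtain ⟨y, hyK, hy⟩ := Set.Infinite.exists_accPt_of_subset_isCompact hinf hK inter_subset_right
  have hy' : AccPt y (𝓟 (cbDerivative _ a)) :=
    hy.mono (Filter.principal_mono.2 inter_subset_left)
  exact h.le_bot ⟨hyK, mem_cbDerivative_succ.2 hy'⟩

/-! ### Compact well-ordered spaces -/

/-- The given topology is compact and refines the Hausdorff order topology, so the two agree.
Closedness of the order is the property that survives passing to subspaces and reordering. -/
theorem CompactSpace.orderTopology {X : Type*} [LinearOrder X] [t : TopologicalSpace X]
    [OrderClosedTopology X] [CompactSpace X] : OrderTopology X := by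
  refine ⟨?_⟩
  have hle : t ≤ Preorder.topology X := by
    refine le_generateFrom ?_
    rintro s ⟨a, rfl | rfl⟩
    · exact isOpen_Ioi
    · exact isOpen_Iio
  have h2 : @T2Space X (Preorder.topology X) :=
    @OrderClosedTopology.to_t2Space X (Preorder.topology X) _
      (@OrderTopology.to_orderClosedTopology X (Preorder.topology X) _
        (@OrderTopology.mk X (Preorder.topology X) _ rfl))
  refine le_antisymm hle ?_
  rw [← continuous_id_iff_le]
  have hc : @Continuous X X t (Preorder.topology X) id := continuous_id_iff_le.2 hle
  exact @Homeomorph.continuous_invFun X X t (Preorder.topology X)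
    (@Continuous.homeoOfEquivCompactToT2 X X t (Preorder.topology X) _ h2 (Equiv.refl X) hc)

section WellOrder

variable {X : Type*} [LinearOrder X] [WellFoundedLT X] [TopologicalSpace X]

theorem isOpen_Iic_of_isOpen_Iio (h : ∀ x : X, IsOpen (Iio x)) (x : X) : IsOpen (Iic x) := by
  by_cases hx : (Ioi x).Nonempty
  · have : Iic x = Iio (wellFounded_lt.min (Ioi x) hx) := by
      ext y
      constructor
      · exact fun hy => lt_of_le_of_lt hy (wellFounded_lt.min_mem (Ioi x) hx)
      · intro hy
        by_contra hxy
        exact wellFounded_lt.not_lt_min (Ioi x) (not_le.1 hxy) hy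
    rw [this]
    exact h _
  · have : Iic x = univ := by
      ext y
      simp only [mem_Iic, mem_univ, iff_true]
      by_contra hxy
      exact hx ⟨y, not_le.1 hxy⟩
    rw [this]
    exact isOpen_univ

theorem orderClosedTopology_of_isOpen (h : ∀ x : X, IsOpen (Iio x)) (h' : ∀ x : X, IsOpen (Ioi x)) :
    OrderClosedTopology X := by
  refine ⟨⟨?_⟩⟩
  have : {p : X × X | p.1 ≤ p.2}ᶜ = ⋃ b, Ioi b ×ˢ Iic b := by
    ext ⟨x, y⟩
    simp only [mem_compl_iff, mem_ofPred_eq, not_le, mem_iUnion, mem_prod, mem_Ioi, mem_Iic]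
    exact ⟨fun h => ⟨y, h, le_rfl⟩, fun ⟨b, h1, h2⟩ => h2.trans_lt h1⟩
  rw [this]
  exact isOpen_iUnion fun b => (h' b).prod (isOpen_Iic_of_isOpen_Iio h b)

theorem isClopen_Iic_of_wellFoundedLT [OrderClosedTopology X] (x : X) : IsClopen (Iic x) :=
  ⟨isClosed_Iic, isOpen_Iic_of_isOpen_Iio (fun _ => isOpen_Iio) x⟩

/-- A well-ordered space has no nonempty dense-in-itself subset. -/
theorem eq_empty_of_subset_derivedSet [OrderClosedTopology X] {S : Set X} (h : S ⊆ derivedSet S) :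
    S = ∅ := by
  by_contra hS
  replace hS := nonempty_iff_ne_empty.2 hS
  have hm := wellFounded_lt.min_mem S hS
  have h1 := accPt_iff_frequently.1 (h hm)
  obtain ⟨y, ⟨hy, hyS⟩, hym⟩ := (h1.and_eventually
    ((isClopen_Iic_of_wellFoundedLT _).isOpen.mem_nhds (mem_Iic.2 le_rfl))).exists
  exact wellFounded_lt.not_lt_min S hyS (lt_of_le_of_ne hym hy)

end WellOrder

/-- Since p is last, the image is the clopen set `Iic (f p)`. Derivatives restrict to it, so f p
lies in {q}, and q being last makes f onto. -/
theorem nonempty_homeomorph_of_initialSeg {X Y : Type u} [LinearOrder X]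
    [TopologicalSpace X] [OrderClosedTopology X] [CompactSpace X] [LinearOrder Y]
    [WellFoundedLT Y] [TopologicalSpace Y] [OrderClosedTopology Y] [CompactSpace Y] {a : Ordinal}
    {p : X} {q : Y} (hp : cbDerivative _ a = {p}) (hpt : ∀ x, x ≤ p)
    (hq : cbDerivative _ a = {q}) (hqt : ∀ y, y ≤ q) (f : X ≤i Y) :
    Nonempty (X ≃ₜ Y) := by
  have := CompactSpace.orderTopology (X := X)
  have := CompactSpace.orderTopology (X := Y)
  have hr : range f = Iic (f p) := by
    ext y
    constructor
    · rintro ⟨x, rfl⟩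
      exact f.monotone (hpt x)
    · intro hy
      exact f.mem_range_of_le hy
  have hemb : IsEmbedding f :=
    f.strictMono.isEmbedding_of_ordConnected (by rw [hr]; exact ordConnected_Iic)
  have hopen : IsOpenEmbedding f :=
    ⟨hemb, by rw [hr]; exact (isClopen_Iic_of_wellFoundedLT _).isOpen⟩
  have hfp : f p = q := by
    have h1 := hopen.preimage_cbDerivative a
    rw [hp, hq] at h1
    have h2 : p ∈ f ⁻¹' {q} := by rw [h1]; rfl
    exact h2
  refine ⟨hemb.toHomeomorphOfSurjective fun y => ?_⟩
  have : y ∈ range f := by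
    rw [hr, hfp]
    exact hqt y
  exact this

theorem nonempty_homeomorph_of_top {X Y : Type u} [LinearOrder X] [WellFoundedLT X]
    [TopologicalSpace X] [OrderClosedTopology X] [CompactSpace X] [LinearOrder Y]
    [WellFoundedLT Y] [TopologicalSpace Y] [OrderClosedTopology Y] [CompactSpace Y] {a : Ordinal}
    {p : X} {q : Y} (hp : cbDerivative _ a = {p}) (hpt : ∀ x, x ≤ p)
    (hq : cbDerivative _ a = {q}) (hqt : ∀ y, y ≤ q) :
    Nonempty (X ≃ₜ Y) := by
  rcases InitialSeg.total (α := X) (β := Y) (· < ·) (· < ·) with f | f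
  · exact nonempty_homeomorph_of_initialSeg hp hpt hq hqt f
  · exact (nonempty_homeomorph_of_initialSeg hq hqt hp hpt f).map Homeomorph.symm

theorem exists_linearOrder_of_injective {X A : Type*} [TopologicalSpace X] [LinearOrder A]
    [WellFoundedLT A] (f : X → A) (hf : Function.Injective f) (h : ∀ a, IsOpen {x | f x < f a})
    (h' : ∀ a, IsOpen {x | f a < f x}) {p : X} (hp : ∀ x, f x ≤ f p) :
    ∃ _ : LinearOrder X, WellFoundedLT X ∧ OrderClosedTopology X ∧ ∀ x, x ≤ p := by
  let lo : LinearOrder X := LinearOrder.lift' f hf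
  have : WellFoundedLT X := ⟨InvImage.wf f wellFounded_lt⟩
  exact ⟨lo, this, orderClosedTopology_of_isOpen h h', hp⟩

/-- A well-ordered space can be reordered so that a given point becomes the greatest one: move
everything above that point to the beginning. -/
theorem exists_linearOrder_top {X : Type*} [LinearOrder X] [WellFoundedLT X]
    [TopologicalSpace X] [OrderClosedTopology X] (p : X) :
    ∃ _ : LinearOrder X, WellFoundedLT X ∧ OrderClosedTopology X ∧ ∀ x, x ≤ p := by
  have hcl : ∀ s : Set Bool, IsOpen ((fun x : X => decide (x ≤ p)) ⁻¹' s) := by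
    intro s
    refine IsOpen.preimage ?_ (isOpen_discrete s)
    refine (IsLocallyConstant.iff_exists_open _).2 (fun x => ?_) |>.continuous
    by_cases hx : x ≤ p
    · exact ⟨Iic p, (isClopen_Iic_of_wellFoundedLT p).isOpen, hx, fun y hy => by
        simp [hx, mem_Iic.1 hy]⟩
    · exact ⟨Ioi p, isOpen_Ioi, not_le.1 hx, fun y hy => by
        simp [hx, not_le.2 (mem_Ioi.1 hy)]⟩
  -- Lexicographically `false` precedes `true`, so the points above p come first and p ends the
  -- second block.
  refine exists_linearOrder_of_injective (A := Bool ×ₗ X)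
    (fun x => toLex (decide (x ≤ p), x)) (fun x y h => ?_) (fun a => ?_) (fun a => ?_) (fun x => ?_)
  · simpa using congrArg (fun z => (ofLex z).2) h
  · simp only [Prod.Lex.lt_iff, ofLex_toLex]
    exact (hcl {b | b < decide (a ≤ p)}).union
      ((hcl {b | b = decide (a ≤ p)}).inter (isOpen_Iio (a := a)))
  · simp only [Prod.Lex.lt_iff, ofLex_toLex]
    exact (hcl {b | decide (a ≤ p) < b}).union
      ((hcl {b | decide (a ≤ p) = b}).inter (isOpen_Ioi (a := a)))
  · simp only [Prod.Lex.le_iff, ofLex_toLex]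
    by_cases hx : x ≤ p
    · simp [hx]
    · simp [hx]

/-- Compact well-ordered spaces whose `a`-th derived sets are singletons are homeomorphic. -/
theorem nonempty_homeomorph_of_cbDerivative_eq_singleton {X Y : Type u} [LinearOrder X]
    [WellFoundedLT X] [TopologicalSpace X] [OrderClosedTopology X] [CompactSpace X] [LinearOrder Y]
    [WellFoundedLT Y] [TopologicalSpace Y] [OrderClosedTopology Y] [CompactSpace Y] {a : Ordinal}
    {p : X} {q : Y} (hp : cbDerivative _ a = {p})
    (hq : cbDerivative _ a = {q}) : Nonempty (X ≃ₜ Y) := by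
  obtain ⟨lX, hX, hX', hpt⟩ := exists_linearOrder_top p
  obtain ⟨lY, hY, hY', hqt⟩ := exists_linearOrder_top q
  exact @nonempty_homeomorph_of_top X Y lX hX _ hX' _ lY hY _ hY' _ a p q hp hpt hq hqt

/-! ### Counting points of a subset of a well-ordered space -/

/-- The number of elements of `S` below `x`. -/
noncomputable def countBelow {X : Type*} [LinearOrder X] (S : Set X) (x : X) : ℕ :=
  (S ∩ Iio x).ncard

section countBelow

variable {X : Type*} [LinearOrder X] {S : Set X}

theorem countBelow_mono (hS : ∀ x, (S ∩ Iio x).Finite) : Monotone (countBelow S) :=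
  fun _ y hxy => ncard_le_ncard (inter_subset_inter_right _ (Iio_subset_Iio hxy)) (hS y)

theorem countBelow_lt (hS : ∀ x, (S ∩ Iio x).Finite) {x y : X} (hx : x ∈ S) (hxy : x < y) :
    countBelow S x < countBelow S y :=
  ncard_lt_ncard ⟨inter_subset_inter_right _ (Iio_subset_Iio hxy.le),
    fun h => lt_irrefl x (h ⟨hx, hxy⟩).2⟩ (hS y)

theorem countBelow_injOn (hS : ∀ x, (S ∩ Iio x).Finite) : InjOn (countBelow S) S := by
  intro x hx y hy h
  rcases lt_trichotomy x y with hxy | hxy | hxy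
  · exact absurd h (countBelow_lt hS hx hxy).ne
  · exact hxy
  · exact absurd h (countBelow_lt hS hy hxy).ne'

theorem exists_countBelow_eq (hS : ∀ x, (S ∩ Iio x).Finite) (hinf : S.Infinite) (n : ℕ) :
    ∃ x ∈ S, countBelow S x = n := by
  obtain ⟨_, ⟨y, hy, rfl⟩, hny⟩ := (hinf.image (countBelow_injOn hS)).exists_gt n
  have h1 : countBelow S '' (S ∩ Iio y) = Iio (countBelow S y) := by
    refine eq_of_subset_of_ncard_le ?_ ?_ (finite_Iio _)
    · rintro _ ⟨x, ⟨hx, hxy⟩, rfl⟩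
      exact countBelow_lt hS hx hxy
    · rw [((countBelow_injOn hS).mono inter_subset_left).ncard_image, ← Finset.coe_Iio,
        ncard_coe_finset, Nat.card_Iio, countBelow]
  have h2 : n ∈ countBelow S '' (S ∩ Iio y) := by rw [h1]; exact hny
  obtain ⟨x, hx, hxn⟩ := h2
  exact ⟨x, hx.1, hxn⟩

/-- The count jumps only just after a point of S, and `Iic x` is clopen. The fibres thus cut the
space into clopen intervals, each ending at a point of S except possibly the last. -/
theorem continuous_countBelow [WellFoundedLT X] [TopologicalSpace X] [OrderClosedTopology X]
    (hS : ∀ x, (S ∩ Iio x).Finite) : Continuous (countBelow S) := by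
  refine IsLocallyConstant.continuous ((IsLocallyConstant.iff_exists_open _).2 fun x => ?_)
  refine ⟨Iic x ∩ ⋂ s ∈ S ∩ Iio x, Ioi s, ?_, ?_, ?_⟩
  · exact (isClopen_Iic_of_wellFoundedLT x).isOpen.inter
      ((hS x).isOpen_biInter fun s _ => isOpen_Ioi)
  · refine ⟨le_rfl, mem_iInter₂.2 fun s hs => hs.2⟩
  · rintro y ⟨hyx, hy⟩
    rw [mem_iInter₂] at hy
    refine le_antisymm (countBelow_mono hS hyx) ?_
    exact ncard_le_ncard (fun s hs => ⟨hs.1, hy s hs⟩) (hS y)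

end countBelow

/-! ### The complement of the last point -/

section

variable {N : Type u} [LinearOrder N] [WellFoundedLT N] [TopologicalSpace N]
  [OrderClosedTopology N] {b : Ordinal.{u}}

/-- The preimage of a set under an inclusion is an intersection. -/
def homeomorphPreimageVal {X : Type*} [TopologicalSpace X] (U W : Set X) :
    ↥((Subtype.val : U → X) ⁻¹' W) ≃ₜ ↥(U ∩ W) where
  toFun x := ⟨x.1, x.1.2, x.2⟩
  invFun x := ⟨⟨x, x.2.1⟩, x.2.2⟩
  left_inv _ := rfl
  right_inv _ := rfl
  continuous_toFun := by fun_prop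
  continuous_invFun := by fun_prop

theorem finite_cbDerivative_inter_Iio {N : Type u} [LinearOrder N] [TopologicalSpace N]
    {b : Ordinal.{u}} (hK : ∀ x : N, IsCompact (Iic x))
    (hb : cbDerivative N (b + 1) = ∅) (U : Set N) (x : N) :
    (U ∩ cbDerivative N b ∩ Iio x).Finite :=
  (finite_cbDerivative_inter_of_isCompact (hK x) (by rw [hb]; exact disjoint_bot_right)).subset
    fun _ hy => ⟨hy.1.2, hy.2.le⟩

/-- The n-th fibre lies below the n-th point of S, hence in a compact initial segment. -/
theorem isCompact_fiber_countBelow (hK : ∀ x : N, IsCompact (Iic x))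
    (hb : cbDerivative N (b + 1) = ∅) {U : Set N} (hU : IsClopen U)
    (hUM : (U ∩ cbDerivative N b).Infinite) (n : ℕ) :
    IsCompact (U ∩ countBelow (U ∩ cbDerivative N b) ⁻¹' {n}) := by
  have hS := finite_cbDerivative_inter_Iio hK hb U
  obtain ⟨m, hm, hmn⟩ := exists_countBelow_eq hS hUM n
  refine (hK m).of_isClosed_subset
    (hU.isClosed.inter ((isClosed_discrete _).preimage (continuous_countBelow hS))) ?_
  rintro x ⟨hxU, hx⟩
  by_contra hxm
  have := countBelow_lt hS hm (not_le.1 hxm)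
  rw [hmn, show countBelow _ x = n from hx] at this
  exact lt_irrefl _ this

theorem exists_cbDerivative_fiber_countBelow (hK : ∀ x : N, IsCompact (Iic x))
    (hb : cbDerivative N (b + 1) = ∅) {U : Set N} (hU : IsClopen U)
    (hUM : (U ∩ cbDerivative N b).Infinite) (n : ℕ) :
    ∃ m, cbDerivative ↥(U ∩ countBelow (U ∩ cbDerivative N b) ⁻¹' {n}) b = {m} := by
  have hS := finite_cbDerivative_inter_Iio hK hb U
  obtain ⟨m, hm, hmn⟩ := exists_countBelow_eq hS hUM n
  refine ⟨⟨m, hm.1, hmn⟩, ?_⟩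
  have hopen : IsOpen (U ∩ countBelow (U ∩ cbDerivative N b) ⁻¹' {n}) :=
    hU.isOpen.inter ((isOpen_discrete _).preimage (continuous_countBelow hS))
  rw [← hopen.isOpenEmbedding_subtypeVal.preimage_cbDerivative]
  ext ⟨x, hx⟩
  rw [mem_preimage, mem_singleton_iff, Subtype.ext_iff]
  constructor
  · intro h
    exact countBelow_injOn hS ⟨hx.1, h⟩ hm (hx.2.trans hmn.symm)
  · intro h
    exact (show x = m from h) ▸ hm.2

/-- Either set is a sum over ℕ of compact pieces with one rank-b point each. By the classification
all pieces are copies of the first piece of U, so both sets are ℕ times that piece. -/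
theorem nonempty_homeomorph_of_infinite (hK : ∀ x : N, IsCompact (Iic x))
    (hb : cbDerivative N (b + 1) = ∅) {U V : Set N} (hU : IsClopen U) (hV : IsClopen V)
    (hUM : (U ∩ cbDerivative N b).Infinite) (hVM : (V ∩ cbDerivative N b).Infinite) :
    Nonempty (U ≃ₜ V) := by
  have key : ∀ W : Set N, IsClopen W → (W ∩ cbDerivative N b).Infinite →
      Nonempty (W ≃ₜ ℕ × ↥(U ∩ countBelow (U ∩ cbDerivative N b) ⁻¹' {0})) := by
    intro W hW hWM
    have hS := finite_cbDerivative_inter_Iio hK hb W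
    have e : ∀ n, Nonempty (↥((fun x : W => countBelow (W ∩ cbDerivative N b) x) ⁻¹' {n}) ≃ₜ
        ↥(U ∩ countBelow (U ∩ cbDerivative N b) ⁻¹' {0})) := by
      intro n
      have h1 := isCompact_iff_compactSpace.1 (isCompact_fiber_countBelow hK hb hW hWM n)
      have h2 := isCompact_iff_compactSpace.1 (isCompact_fiber_countBelow hK hb hU hUM 0)
      obtain ⟨m, hm⟩ := exists_cbDerivative_fiber_countBelow hK hb hW hWM n
      obtain ⟨m', hm'⟩ := exists_cbDerivative_fiber_countBelow hK hb hU hUM 0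
      exact (nonempty_homeomorph_of_cbDerivative_eq_singleton hm hm').map
        (homeomorphPreimageVal W _).trans
    obtain ⟨E, -⟩ := exists_homeomorph_prod_of_fibers
      ((continuous_countBelow hS).comp continuous_subtype_val) fun n => (e n).some
    exact ⟨E⟩
  obtain ⟨e⟩ := key U hU hUM
  obtain ⟨f⟩ := key V hV hVM
  exact ⟨e.trans f.symm⟩

theorem isSelfSimilarFor_cbDerivative (hK : ∀ x : N, IsCompact (Iic x))
    (hb : cbDerivative N (b + 1) = ∅) (hinf : (cbDerivative N b).Infinite) :
    IsSelfSimilarFor (cbDerivative N b) where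
  apply_mem_iff g x := g.apply_mem_cbDerivative b x
  infinite := hinf
  nonempty_homeomorph _ _ hU hV hUM hVM := nonempty_homeomorph_of_infinite hK hb hU hV hUM hVM
  exists_split U hU hUM := by
    have hS := finite_cbDerivative_inter_Iio hK hb U
    -- Grouping the pieces by the first coordinate of a pairing of ℕ puts infinitely many into each
    -- group.
    refine ⟨fun x => (Nat.unpair (countBelow (U ∩ cbDerivative N b) x)).1,
      (continuous_of_discreteTopology (f := fun n : ℕ => (Nat.unpair n).1)).comp
        (continuous_countBelow hS), fun n => ?_⟩
    choose m hm hmn using exists_countBelow_eq hS hUM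
    have hinj : Function.Injective fun k => m (Nat.pair n k) := by
      intro k l h
      have h1 := congrArg (countBelow (U ∩ cbDerivative N b)) h
      simp only [hmn] at h1
      simpa using congrArg (fun z => (Nat.unpair z).2) h1
    refine (infinite_range_of_injective hinj).mono ?_
    rintro _ ⟨k, rfl⟩
    refine ⟨⟨(hm _).1, ?_⟩, (hm _).2⟩
    simp [hmn]

end

/-- If the `(b + 1)`-st derivative of a compact well-ordered space is a point, then the
homeomorphism group of the complement of that point is bounded. -/
theorem lengthBounded_homeomorph_compl_singleton {Z : Type u} [LinearOrder Z] [WellFoundedLT Z]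
    [TopologicalSpace Z] [OrderClosedTopology Z] [CompactSpace Z] {b : Ordinal.{u}} {p : Z}
    (hp : cbDerivative Z (b + 1) = {p}) :
    LengthBounded (univ : Set (↥({p}ᶜ : Set Z) ≃ₜ ↥({p}ᶜ : Set Z))) := by
  -- With p last, initial segments of the complement are closed in Z, hence compact.
  obtain ⟨lo, hwf, hoc, htop⟩ := exists_linearOrder_top p
  have hemb := (isOpen_compl_singleton (x := p)).isOpenEmbedding_subtypeVal
  refine (@isSelfSimilarFor_cbDerivative _ (@Subtype.instLinearOrder Z lo _) ?_ _ ?_ b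
    ?_ ?_ ?_).lengthBounded_univ
  · infer_instance
  · infer_instance
  · intro x
    rw [hemb.isInducing.isCompact_iff]
    have : Subtype.val '' (Iic x) = Iic (x : Z) := by
      ext y
      constructor
      · rintro ⟨z, hz, rfl⟩
        exact hz
      · intro hy
        refine ⟨⟨y, ?_⟩, hy, rfl⟩
        rintro rfl
        exact x.2 (le_antisymm (htop _) hy)
    rw [this]
    exact isClosed_Iic.isCompact
  · rw [← hemb.preimage_cbDerivative, hp]
    ext x
    simp
  · rw [← hemb.preimage_cbDerivative]
    have hacc : AccPt p (𝓟 (cbDerivative Z b)) := by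
      rw [← mem_cbDerivative_succ, hp]; rfl
    intro hfin
    refine (Set.Infinite.of_accPt hacc) (((hfin.image Subtype.val).insert p).subset fun x hx => ?_)
    by_cases hxp : x = p
    · exact Or.inl hxp
    · exact Or.inr ⟨⟨x, hxp⟩, hx, rfl⟩

/-! ### Homeomorphisms supported in a clopen set -/

/-- Z is the one-point compactification of the complement of p, to which homeomorphisms extend. -/
theorem exists_homeomorph_extend_compl_singleton {Z : Type*} [TopologicalSpace Z] [T2Space Z]
    [CompactSpace Z] (p : Z) (f : ↥({p}ᶜ : Set Z) ≃ₜ ↥({p}ᶜ : Set Z)) :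
    ∃ t : Z ≃ₜ Z, t p = p ∧ ∀ x : ↥({p}ᶜ : Set Z), t x = f x := by
  let E := OnePoint.equivOfIsEmbeddingOfRangeEq (y := p) (Subtype.val : ↥({p}ᶜ : Set Z) → Z)
    IsEmbedding.subtypeVal Subtype.range_coe
  have h1 : E OnePoint.infty = p := rfl
  have h2 : ∀ x : ↥({p}ᶜ : Set Z), E (x : OnePoint _) = x := fun x => rfl
  refine ⟨(E.symm.trans f.onePointCongr).trans E, ?_, fun x => ?_⟩
  · have : E.symm p = OnePoint.infty := by rw [Homeomorph.symm_apply_eq, h1]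
    simp only [Homeomorph.trans_apply, this]
    exact h1
  · have : E.symm x = (x : OnePoint _) := by rw [Homeomorph.symm_apply_eq, h2]
    simp only [Homeomorph.trans_apply, this]
    exact h2 _

theorem lengthBounded_homeomorph_of_compl_singleton {Z : Type*} [TopologicalSpace Z] [T2Space Z]
    [CompactSpace Z] {p : Z}
    (h : LengthBounded (univ : Set (↥({p}ᶜ : Set Z) ≃ₜ ↥({p}ᶜ : Set Z))))
    (hp : ∀ g : Z ≃ₜ Z, g p = p) : LengthBounded (univ : Set (Z ≃ₜ Z)) := by
  choose t ht ht' using exists_homeomorph_extend_compl_singleton (Z := Z) p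
  have key : ∀ (f) (g : Z ≃ₜ Z), g p = p → (∀ x : ↥({p}ᶜ : Set Z), g x = f x) → t f = g := by
    intro f g hg hg'
    ext x
    by_cases hx : x = p
    · rw [hx, ht, hg]
    · rw [ht' f ⟨x, hx⟩, hg' ⟨x, hx⟩]
  let φ : (↥({p}ᶜ : Set Z) ≃ₜ ↥({p}ᶜ : Set Z)) →* (Z ≃ₜ Z) :=
    { toFun := t
      map_one' := key _ _ rfl fun x => rfl
      map_mul' := fun f g => key _ _ (by rw [Homeomorph.mul_apply, ht, ht]) fun x => by
        rw [Homeomorph.mul_apply, ht', ht']; rfl }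
  have : φ '' univ = univ := by
    refine eq_univ_of_forall fun g => ?_
    refine ⟨g.subtype fun x => ?_, trivial, key _ _ (hp g) fun x => rfl⟩
    change x ≠ p ↔ g x ≠ p
    conv_rhs => rw [← hp g]
    exact g.injective.ne_iff.symm
  rw [← this]
  exact h.image φ

theorem lengthBounded_supportedIn_of_isClopen {X : Type*} [TopologicalSpace X] {A : Set X}
    (hA : IsClopen A) (h : LengthBounded (univ : Set (A ≃ₜ A))) :
    LengthBounded (supportedIn A : Set (X ≃ₜ X)) := by
  choose t ht ht' using fun f : A ≃ₜ A => exists_homeomorph_glue hA hA f (Homeomorph.refl _)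
  have key : ∀ (f) (g : X ≃ₜ X), (∀ x ∉ A, g x = x) → (∀ x : A, g x = f x) → t f = g := by
    intro f g hg hg'
    ext x
    by_cases hx : x ∈ A
    · rw [ht f ⟨x, hx⟩, hg' ⟨x, hx⟩]
    · rw [hg x hx]
      exact ht' f ⟨x, hx⟩
  have ht'' : ∀ f, ∀ x ∉ A, t f x = x := fun f x hx => ht' f ⟨x, hx⟩
  let φ : (A ≃ₜ A) →* (X ≃ₜ X) :=
    { toFun := t
      map_one' := key _ _ (fun _ _ => rfl) fun x => rfl
      map_mul' := fun f g => key _ _ (fun x hx => by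
        rw [Homeomorph.mul_apply, ht'' g x hx, ht'' f x hx]) fun x => by
        rw [Homeomorph.mul_apply, ht, ht]; rfl }
  have : (supportedIn A : Set (X ≃ₜ X)) ⊆ φ '' univ := by
    intro g hg
    exact ⟨g.subtype fun x => (supportedIn_apply_mem_iff hg).symm, trivial,
      key _ _ hg fun x => rfl⟩
  intro L hL
  obtain ⟨C, hC⟩ := h.image φ L hL
  exact ⟨C, fun g hg => hC g (this hg)⟩

section

variable {X : Type u} [LinearOrder X] [WellFoundedLT X] [TopologicalSpace X]
  [OrderClosedTopology X] [CompactSpace X] {b : Ordinal.{u}}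

theorem cbDerivative_coe_eq_singleton {X : Type u} [TopologicalSpace X] {b : Ordinal.{u}}
    {A : Set X} (hA : IsOpen A) {p : X} (hp : A ∩ cbDerivative X b = {p}) :
    cbDerivative A b = {⟨p, (hp.symm.subset rfl).1⟩} := by
  rw [← hA.isOpenEmbedding_subtypeVal.preimage_cbDerivative]
  ext ⟨x, hx⟩
  rw [mem_preimage, mem_singleton_iff, Subtype.ext_iff]
  constructor
  · exact fun h => hp.subset ⟨hx, h⟩
  · intro h
    exact (hp.symm.subset (show x = p from h)).2

theorem nonempty_homeomorph_of_inter_eq_singleton {A B : Set X} (hA : IsClopen A)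
    (hB : IsClopen B) {p q : X} (hp : A ∩ cbDerivative X b = {p})
    (hq : B ∩ cbDerivative X b = {q}) : Nonempty (A ≃ₜ B) := by
  have := isCompact_iff_compactSpace.1 hA.isClosed.isCompact
  have := isCompact_iff_compactSpace.1 hB.isClosed.isCompact
  exact nonempty_homeomorph_of_cbDerivative_eq_singleton
    (cbDerivative_coe_eq_singleton hA.isOpen hp) (cbDerivative_coe_eq_singleton hB.isOpen hq)

theorem lengthBounded_supportedIn {A : Set X} (hA : IsClopen A) {p : X}
    (hp : A ∩ cbDerivative X (b + 1) = {p}) :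
    LengthBounded (supportedIn A : Set (X ≃ₜ X)) := by
  have := isCompact_iff_compactSpace.1 hA.isClosed.isCompact
  have h := cbDerivative_coe_eq_singleton hA.isOpen hp
  refine lengthBounded_supportedIn_of_isClopen hA
    (lengthBounded_homeomorph_of_compl_singleton (lengthBounded_homeomorph_compl_singleton h)
      fun g => ?_)
  have h1 := (g.apply_mem_cbDerivative (b + 1) ⟨p, (hp.symm.subset rfl).1⟩).2 (by rw [h]; rfl)
  rwa [h] at h1

end

/-! ### Generating the homeomorphism group -/

section Generation

variable {X : Type u} [LinearOrder X] [WellFoundedLT X] [TopologicalSpace X]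
  [OrderClosedTopology X] [CompactSpace X] {b : Ordinal.{u}}
  [Finite (cbDerivative X (b + 1))] {π : X → cbDerivative X (b + 1)}
  {K : Subgroup (X ≃ₜ X)} {p₀ : cbDerivative X (b + 1)}

theorem fiber_inter_cbDerivative {X : Type u} [TopologicalSpace X] {a : Ordinal.{u}}
    {π : X → cbDerivative X a} (hπ' : ∀ p : cbDerivative X a, π p = p) (p : cbDerivative X a) :
    π ⁻¹' {p} ∩ cbDerivative X a = {(p : X)} := by
  ext x
  constructor
  · rintro ⟨hx, hxP⟩
    have := hπ' ⟨x, hxP⟩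
    rw [show π x = p from hx] at this
    rw [this]; rfl
  · rintro rfl
    exact ⟨hπ' p, p.2⟩

theorem fiber_diff_inter_cbDerivative {X : Type u} [TopologicalSpace X] {a : Ordinal.{u}}
    {π : X → cbDerivative X a} (hπ' : ∀ p : cbDerivative X a, π p = p) {p : cbDerivative X a}
    {E : Set X} (hpE : (p : X) ∉ E) : (π ⁻¹' {p} \ E) ∩ cbDerivative X a = {(p : X)} := by
  rw [sdiff_inter_right_comm, fiber_inter_cbDerivative hπ' p]
  ext x
  exact ⟨fun h => h.1, fun h => ⟨h, (show x = p from h) ▸ hpE⟩⟩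

theorem Homeomorph.mul_image {X : Type*} [TopologicalSpace X] (g h : X ≃ₜ X) (S : Set X) :
    (g * h) '' S = g '' (h '' S) := image_comp g h S

theorem Homeomorph.inv_image_image {X : Type*} [TopologicalSpace X] (g : X ≃ₜ X) (S : Set X) :
    (g⁻¹ : X ≃ₜ X) '' (g '' S) = S := by
  rw [← Homeomorph.mul_image, inv_mul_cancel]
  exact image_id S


/-- A clopen set containing one point of the `b`-th derivative can be moved from the fibre of `p`
to the fibre of `p₀`. -/
theorem exists_push_of_eq_singleton (hπ : Continuous π) (hπ' : ∀ p : cbDerivative X (b + 1), π p = p)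
    {p : cbDerivative X (b + 1)} (hK : supportedIn (π ⁻¹' {p}) ≤ K) {Y : Set X} (hY : IsClopen Y)
    (hYp : Y ⊆ π ⁻¹' {p}) (hpY : (p : X) ∉ Y) {y : X} (hy : Y ∩ cbDerivative X b = {y})
    {s : X ≃ₜ X} (hsK : s ∈ K) (hs : s '' (π ⁻¹' {p} \ Y) = π ⁻¹' {p})
    (hs' : ∀ x, π x ≠ p → π x ≠ p₀ → s x = x) {E : Set X} (hE : IsClopen E)
    (hEp : E ⊆ π ⁻¹' {p}) (hpE : (p : X) ∉ E) {m : X} (hm : E ∩ cbDerivative X b = {m}) :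
    ∃ k ∈ K, k '' (π ⁻¹' {p} \ E) = π ⁻¹' {p} ∧ ∀ x, π x ≠ p → π x ≠ p₀ → k x = x := by
  have hF : IsClopen (π ⁻¹' {p}) := (isClopen_discrete _).preimage hπ
  obtain ⟨e⟩ := nonempty_homeomorph_of_inter_eq_singleton hE hY hm hy
  -- E and Y match by their single rank-b point, their complements in the fibre by the single point
  -- p of the next derivative.
  obtain ⟨f⟩ := nonempty_homeomorph_of_inter_eq_singleton (hF.diff hE) (hF.diff hY)
    (fiber_diff_inter_cbDerivative hπ' hpE) (fiber_diff_inter_cbDerivative hπ' hpY)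
  obtain ⟨h, -, hf, hoff⟩ := exists_homeomorph_supported hF hE hY hEp hYp e f
  refine ⟨s * h, mul_mem hsK (hK hoff), ?_, fun x hx hx' => ?_⟩
  · have : h '' (π ⁻¹' {p} \ E) = π ⁻¹' {p} \ Y := by
      ext z
      constructor
      · rintro ⟨x, hx, rfl⟩
        rw [hf ⟨x, hx⟩]
        exact (f _).2
      · intro hz
        refine ⟨f.symm ⟨z, hz⟩, (f.symm ⟨z, hz⟩).2, ?_⟩
        rw [hf, f.apply_symm_apply]
    rw [Homeomorph.mul_image, this, hs]
  · rw [Homeomorph.mul_apply, hoff x hx, hs' x hx hx']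

/-- Induction on the number of rank-b points: cut E just after its least one, push that piece out,
and continue with the image of the rest. At least one such point is needed, as each piece pushed
must be a copy of Y. -/
theorem exists_push (hπ : Continuous π) (hπ' : ∀ p : cbDerivative X (b + 1), π p = p)
    {p : cbDerivative X (b + 1)} (hK : supportedIn (π ⁻¹' {p}) ≤ K) {Y : Set X} (hY : IsClopen Y)
    (hYp : Y ⊆ π ⁻¹' {p}) (hpY : (p : X) ∉ Y) {y : X} (hy : Y ∩ cbDerivative X b = {y})
    {s : X ≃ₜ X} (hsK : s ∈ K) (hs : s '' (π ⁻¹' {p} \ Y) = π ⁻¹' {p})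
    (hs' : ∀ x, π x ≠ p → π x ≠ p₀ → s x = x) (n : ℕ) {E : Set X} (hE : IsClopen E)
    (hEp : E ⊆ π ⁻¹' {p}) (hpE : (p : X) ∉ E) (hn : (E ∩ cbDerivative X b).ncard = n + 1) :
    ∃ k ∈ K, k '' (π ⁻¹' {p} \ E) = π ⁻¹' {p} ∧ ∀ x, π x ≠ p → π x ≠ p₀ → k x = x := by
  induction n generalizing E with
  | zero =>
    obtain ⟨m, hm⟩ := ncard_eq_one.1 hn
    exact exists_push_of_eq_singleton hπ hπ' hK hY hYp hpY hy hsK hs hs' hE hEp hpE hm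
  | succ n ih =>
    have hne : (E ∩ cbDerivative X b).Nonempty := nonempty_of_ncard_ne_zero (by omega)
    set m := wellFounded_lt.min _ hne with hm
    have hmE : m ∈ E ∩ cbDerivative X b := wellFounded_lt.min_mem _ hne
    have hIic := isClopen_Iic_of_wellFoundedLT m
    have hmin : ∀ x ∈ E ∩ cbDerivative X b, x ≤ m → x = m := fun x hx hxm =>
      le_antisymm hxm (not_lt.1 (wellFounded_lt.not_lt_min _ hx))
    have hE₁ : (E ∩ Iic m) ∩ cbDerivative X b = {m} := by
      ext x
      constructor
      · rintro ⟨⟨hx, hxm⟩, hxD⟩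
        exact hmin x ⟨hx, hxD⟩ hxm
      · rintro rfl
        exact ⟨⟨hmE.1, le_rfl⟩, hmE.2⟩
    obtain ⟨k, hkK, hk, hk'⟩ := exists_push_of_eq_singleton hπ hπ' hK hY hYp hpY hy hsK hs hs'
      (hE.inter hIic) (inter_subset_left.trans hEp) (fun h => hpE h.1) hE₁
    have hE₂ : IsClopen (k '' (E \ Iic m)) :=
      ⟨k.isClosedMap _ (hE.diff hIic).isClosed, k.isOpenMap _ (hE.diff hIic).isOpen⟩
    have hsplit : π ⁻¹' {p} \ E = (π ⁻¹' {p} \ (E ∩ Iic m)) \ (E \ Iic m) := by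
      ext x
      simp only [mem_sdiff, mem_inter_iff]
      tauto
    have hsub : k '' (E \ Iic m) ⊆ π ⁻¹' {p} := by
      conv_rhs => rw [← hk]
      exact image_mono fun x hx => ⟨hEp hx.1, fun h => hx.2 h.2⟩
    have hp₂ : (p : X) ∉ k '' (E \ Iic m) := by
      rintro ⟨x, hx, hxp⟩
      have hxP : x ∈ cbDerivative X (b + 1) := by
        rw [← k.apply_mem_cbDerivative, hxp]
        exact p.2
      have : x = p := (fiber_inter_cbDerivative hπ' p).subset ⟨hEp hx.1, hxP⟩
      exact hpE (this ▸ hx.1)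
    have hcard : (k '' (E \ Iic m) ∩ cbDerivative X b).ncard = n + 1 := by
      have h1 : k '' (E \ Iic m) ∩ cbDerivative X b =
          k '' ((E ∩ cbDerivative X b) \ {m}) := by
        ext z
        constructor
        · rintro ⟨⟨x, hx, rfl⟩, hz⟩
          exact ⟨x, ⟨⟨hx.1, (k.apply_mem_cbDerivative b x).1 hz⟩,
            fun h => hx.2 (le_of_eq h)⟩, rfl⟩
        · rintro ⟨x, hx, rfl⟩
          exact ⟨⟨x, ⟨hx.1.1, fun h => hx.2 (hmin x hx.1 h)⟩, rfl⟩,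
            (k.apply_mem_cbDerivative b x).2 hx.1.2⟩
      rw [h1, k.injective.injOn.ncard_image, ncard_sdiff_singleton_of_mem hmE, hn]
      rfl
    obtain ⟨l, hlK, hl, hl'⟩ := ih hE₂ hsub hp₂ hcard
    refine ⟨l * k, mul_mem hlK hkK, ?_, fun x hx hx' => ?_⟩
    · rw [Homeomorph.mul_image, hsplit, image_sdiff k.injective, hk, hl]
    · rw [Homeomorph.mul_apply, hk' x hx hx', hl' x hx hx']

/-- The homeomorphisms preserving every fibre are products of homeomorphisms supported in the
fibres. -/
theorem mem_of_preserves_fibers {X ι : Type*} [TopologicalSpace X] [TopologicalSpace ι]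
    [DiscreteTopology ι] [Finite ι] {π : X → ι} {K : Subgroup (X ≃ₜ X)} (hπ : Continuous π)
    (hK : ∀ p, supportedIn (π ⁻¹' {p}) ≤ K)
    {g : X ≃ₜ X} (hg : ∀ x, π (g x) = π x) : g ∈ K := by
  classical
  have := Fintype.ofFinite (ι)
  suffices H : ∀ (T : Finset (ι)) (g : X ≃ₜ X), (∀ x, π (g x) = π x) →
      (∀ x, π x ∉ T → g x = x) → g ∈ K from H Finset.univ g hg fun x hx => by simp at hx
  intro T
  induction T using Finset.induction_on with
  | empty =>
    intro g _ hg
    have : g = 1 := by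
      ext x
      exact hg x (by simp)
    rw [this]
    exact one_mem K
  | insert p T hp ih =>
    intro g hg hgT
    have hF : IsClopen (π ⁻¹' {p}) := (isClopen_discrete _).preimage hπ
    obtain ⟨t, ht, -, ht'⟩ := exists_homeomorph_supported hF hF hF subset_rfl subset_rfl
      (g.subtype (p := (· ∈ π ⁻¹' {p})) (q := (· ∈ π ⁻¹' {p})) fun x => by simp [hg])
      (Homeomorph.refl _)
    have htK : t ∈ K := hK p ht'
    have htg : ∀ x, π x = p → t x = g x := fun x hx => ht ⟨x, hx⟩
    have h1 : ∀ x, π x = p → (t⁻¹ * g) x = x := fun x hx => by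
      rw [Homeomorph.mul_apply, ← htg x hx]
      exact t.symm_apply_apply x
    have h2 : ∀ x, π x ≠ p → (t⁻¹ * g) x = g x := fun x hx => by
      rw [Homeomorph.mul_apply]
      have : t (g x) = g x := ht' _ (by simpa [hg] using hx)
      conv_lhs => rw [← this]
      exact t.symm_apply_apply _
    have h3 : t⁻¹ * g ∈ K := by
      refine ih _ (fun x => ?_) fun x hx => ?_
      · by_cases hxp : π x = p
        · rw [h1 x hxp]
        · rw [h2 x hxp, hg]
      · by_cases hxp : π x = p
        · exact h1 x hxp
        · rw [h2 x hxp]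
          exact hgT x (by simp [hxp, hx])
    simpa using mul_mem htK h3

/-- A family of clopen sets avoiding the `(b + 1)`-st derivative can be moved to the fibre of
`p₀` simultaneously. -/
theorem exists_push_all (hπ : Continuous π) (hπ' : ∀ p : cbDerivative X (b + 1), π p = p)
    (hK : ∀ p, supportedIn (π ⁻¹' {p}) ≤ K) {Y : cbDerivative X (b + 1) → Set X}
    (hY : ∀ p, IsClopen (Y p)) (hYp : ∀ p, Y p ⊆ π ⁻¹' {p}) (hpY : ∀ p, (p : X) ∉ Y p)
    {y : cbDerivative X (b + 1) → X} (hy : ∀ p, Y p ∩ cbDerivative X b = {y p})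
    {s : cbDerivative X (b + 1) → X ≃ₜ X} (hsK : ∀ p, s p ∈ K)
    (hs : ∀ p ≠ p₀, s p '' (π ⁻¹' {p} \ Y p) = π ⁻¹' {p})
    (hs' : ∀ p ≠ p₀, ∀ x, π x ≠ p → π x ≠ p₀ → s p x = x) {C : Set X} (hC : IsClopen C)
    (hCP : Disjoint C (cbDerivative X (b + 1)))
    (hCD : ∀ p, (C ∩ π ⁻¹' {p} ∩ cbDerivative X b).Nonempty) :
    ∃ k ∈ K, ∀ p ≠ p₀, k '' (π ⁻¹' {p} \ C) = π ⁻¹' {p} := by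
  classical
  have := Fintype.ofFinite (cbDerivative X (b + 1))
  suffices H : ∀ (T : Finset (cbDerivative X (b + 1))), ∃ k ∈ K,
      (∀ p ∈ T, p ≠ p₀ → k '' (π ⁻¹' {p} \ C) = π ⁻¹' {p}) ∧
      ∀ x, π x ∉ T → π x ≠ p₀ → k x = x by
    obtain ⟨k, hk, h, -⟩ := H Finset.univ
    exact ⟨k, hk, fun p hp => h p (Finset.mem_univ p) hp⟩
  intro T
  induction T using Finset.induction_on with
  | empty => exact ⟨1, one_mem K, by simp, fun _ _ _ => rfl⟩
  | insert p T hpT ih =>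
    obtain ⟨k, hkK, hk, hk'⟩ := ih
    by_cases hp : p = p₀
    · refine ⟨k, hkK, fun q hq hq₀ => ?_, fun x hx hx' => hk' x (fun h => ?_) hx'⟩
      · exact hk q ((Finset.mem_insert.1 hq).resolve_left fun h => hq₀ (h.trans hp)) hq₀
      · exact hx (Finset.mem_insert_of_mem h)
    · have hE : IsClopen (C ∩ π ⁻¹' {p}) := hC.inter ((isClopen_discrete _).preimage hπ)
      have hfin : (C ∩ π ⁻¹' {p} ∩ cbDerivative X b).Finite := by
        rw [inter_comm]
        exact finite_cbDerivative_inter_of_isCompact hE.isClosed.isCompact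
          (hCP.mono_left inter_subset_left)
      obtain ⟨n, hn⟩ := Nat.exists_eq_succ_of_ne_zero
        ((ncard_pos hfin).2 (hCD p)).ne'
      obtain ⟨l, hlK, hl, hl'⟩ := exists_push hπ hπ' (hK p) (hY p) (hYp p) (hpY p) (hy p) (hsK p)
        (hs p hp) (hs' p hp) n hE inter_subset_right
        (fun h => hCP.le_bot ⟨h.1, p.2⟩) hn
      -- l moves only the fibres of p and p₀, so fibres already treated stay as they are.
      refine ⟨l * k, mul_mem hlK hkK, fun q hq hq₀ => ?_, fun x hx hx' => ?_⟩
      · rw [Homeomorph.mul_image]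
        by_cases hqp : q = p
        · subst hqp
          have : k '' (π ⁻¹' {q} \ C) = π ⁻¹' {q} \ (C ∩ π ⁻¹' {q}) := by
            rw [inter_comm, sdiff_self_inter]
            refine (image_congr fun x hx => ?_).trans (image_id _)
            have hxq : π x = q := hx.1
            exact hk' x (by rwa [hxq]) (by rwa [hxq])
          rw [this, hl]
        · rw [hk q ((Finset.mem_insert.1 hq).resolve_left hqp) hq₀]
          refine (image_congr fun x hx => ?_).trans (image_id _)
          have hxq : π x = q := hx
          exact hl' x (by rwa [hxq]) (by rwa [hxq])
      · simp only [Finset.mem_insert, not_or] at hx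
        rw [Homeomorph.mul_apply, hk' x hx.2 hx', hl' x hx.1 hx']

/-- Let C contain all points that change fibre. If k and l push C and g(C) into the fibre of p₀,
then l g k⁻¹ sends every other fibre F to F \ C, then to F \ g(C), then back to F. -/
theorem mem_of_fixes_cbDerivative (hπ : Continuous π) (hπ' : ∀ p : cbDerivative X (b + 1), π p = p)
    (hK : ∀ p, supportedIn (π ⁻¹' {p}) ≤ K) {Y : cbDerivative X (b + 1) → Set X}
    (hY : ∀ p, IsClopen (Y p)) (hYp : ∀ p, Y p ⊆ π ⁻¹' {p}) (hpY : ∀ p, (p : X) ∉ Y p)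
    {y : cbDerivative X (b + 1) → X} (hy : ∀ p, Y p ∩ cbDerivative X b = {y p})
    {s : cbDerivative X (b + 1) → X ≃ₜ X} (hsK : ∀ p, s p ∈ K)
    (hs : ∀ p ≠ p₀, s p '' (π ⁻¹' {p} \ Y p) = π ⁻¹' {p})
    (hs' : ∀ p ≠ p₀, ∀ x, π x ≠ p → π x ≠ p₀ → s p x = x) {g : X ≃ₜ X}
    (hg : ∀ p : cbDerivative X (b + 1), g p = p) : g ∈ K := by
  have hyY : ∀ p, y p ∈ Y p ∧ y p ∈ cbDerivative X b := fun p => (hy p).symm.subset rfl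
  have hYc : IsClopen (⋃ p, Y p) := isClopen_iUnion_of_finite hY
  have hPY : ∀ p : cbDerivative X (b + 1), (p : X) ∉ ⋃ q, Y q := by
    intro p h
    obtain ⟨q, hq⟩ := mem_iUnion.1 h
    have : π p = q := hYp q hq
    rw [hπ'] at this
    exact hpY q (this ▸ hq)
  -- The sets Y p and their preimages are added so that C and g(C) both have a rank-b point in every
  -- fibre, as pushing requires.
  set C : Set X := {x | π (g x) ≠ π x} ∪ ((⋃ p, Y p) ∪ g ⁻¹' (⋃ p, Y p)) with hCdef
  have hC : IsClopen C := by
    refine IsClopen.union ?_ (hYc.union (hYc.preimage g.continuous))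
    exact (isClopen_discrete {z : cbDerivative X (b + 1) × cbDerivative X (b + 1) | z.1 ≠ z.2}).preimage
      ((hπ.comp g.continuous).prodMk hπ)
  have hCg : IsClopen (g '' C) := ⟨g.isClosedMap _ hC.isClosed, g.isOpenMap _ hC.isOpen⟩
  have hCP : ∀ p : cbDerivative X (b + 1), (p : X) ∉ C := by
    rintro p (h | h | h)
    · exact h (by rw [hg])
    · exact hPY p h
    · rw [mem_preimage, hg] at h
      exact hPY p h
  have hCP' : ∀ p : cbDerivative X (b + 1), (p : X) ∉ g '' C := by
    rintro p ⟨x, hx, hxp⟩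
    rw [← hg p] at hxp
    exact hCP p (g.injective hxp ▸ hx)
  obtain ⟨k, hkK, hk⟩ := exists_push_all hπ hπ' hK hY hYp hpY hy hsK hs hs' hC
    (disjoint_left.2 fun x hx hxP => hCP ⟨x, hxP⟩ hx)
    fun p => ⟨y p, ⟨Or.inr (Or.inl (mem_iUnion.2 ⟨p, (hyY p).1⟩)), hYp p (hyY p).1⟩, (hyY p).2⟩
  obtain ⟨l, hlK, hl⟩ := exists_push_all hπ hπ' hK hY hYp hpY hy hsK hs hs' hCg
    (disjoint_left.2 fun x hx hxP => hCP' ⟨x, hxP⟩ hx)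
    fun p => ⟨y p, ⟨⟨g.symm (y p), Or.inr (Or.inr (by
      rw [mem_preimage, g.apply_symm_apply]
      exact mem_iUnion.2 ⟨p, (hyY p).1⟩)), g.apply_symm_apply _⟩, hYp p (hyY p).1⟩, (hyY p).2⟩
  have hgC : ∀ x ∉ C, π (g x) = π x := fun x hx => by
    by_contra h
    exact hx (Or.inl h)
  have hgi : ∀ p, g '' (π ⁻¹' {p} \ C) = π ⁻¹' {p} \ g '' C := by
    intro p
    ext z
    constructor
    · rintro ⟨x, ⟨hx, hxC⟩, rfl⟩
      exact ⟨(hgC x hxC).trans hx, fun h => hxC ((g.injective.mem_set_image).1 h)⟩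
    · rintro ⟨hz, hzC⟩
      have h1 : g.symm z ∉ C := fun h => hzC ⟨_, h, g.apply_symm_apply z⟩
      have h2 := hgC _ h1
      rw [g.apply_symm_apply] at h2
      exact ⟨g.symm z, ⟨h2.symm.trans hz, h1⟩, g.apply_symm_apply z⟩
  have himg : ∀ p ≠ p₀, (l * g * k⁻¹) '' (π ⁻¹' {p}) = π ⁻¹' {p} := by
    intro p hp
    have h1 : (k⁻¹ : X ≃ₜ X) '' (π ⁻¹' {p}) = π ⁻¹' {p} \ C := by
      conv_lhs => rw [← hk p hp]
      rw [Homeomorph.inv_image_image]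
    rw [Homeomorph.mul_image, h1, Homeomorph.mul_image, hgi, hl p hp]
  have hfib : l * g * k⁻¹ ∈ K := by
    refine mem_of_preserves_fibers hπ hK fun x => ?_
    by_cases hx : π x = p₀
    · by_contra h
      rw [hx] at h
      have h1 : (l * g * k⁻¹) x ∈ (l * g * k⁻¹) '' (π ⁻¹' {π ((l * g * k⁻¹) x)}) := by
        rw [himg _ h]; rfl
      have h2 : π x = π ((l * g * k⁻¹) x) := ((l * g * k⁻¹).injective.mem_set_image).1 h1
      exact h (h2.symm.trans hx)
    · exact (himg _ hx).subset ⟨x, rfl, rfl⟩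
  have := mul_mem (mul_mem (inv_mem hlK) hfib) hkK
  rwa [show l⁻¹ * (l * g * k⁻¹) * k = g by group] at this

end Generation

/-! ### Retraction, shifts and swaps: constructing the generators -/

section

variable {X : Type u} [LinearOrder X] [WellFoundedLT X] [TopologicalSpace X]
  [OrderClosedTopology X] {b : Ordinal.{u}}

/-- A finite nonempty subset of a well-ordered space is a retract. -/
theorem exists_retraction_of_finite {X : Type*} [LinearOrder X] [WellFoundedLT X]
    [TopologicalSpace X] [OrderClosedTopology X] {P : Set X} (hP : P.Finite) (hne : P.Nonempty) :
    ∃ π : X → P, Continuous π ∧ ∀ p : P, π p = p := by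
  classical
  have hS : ∀ x, (P ∩ Iio x).Finite := fun x => hP.subset inter_subset_left
  -- This inverts the count on P; the default value serves the points above all of P.
  let φ : ℕ → P := fun n => if h : ∃ p : P, countBelow P p = n then h.choose else ⟨_, hne.some_mem⟩
  refine ⟨fun x => φ (countBelow P x),
    (continuous_of_discreteTopology (f := φ)).comp (continuous_countBelow hS), fun p => ?_⟩
  have h : ∃ q : P, countBelow P q = countBelow P p := ⟨p, rfl⟩
  have h1 : φ (countBelow P p) = h.choose := dif_pos h
  change φ (countBelow P p) = p
  rw [h1]
  exact Subtype.ext (countBelow_injOn hS h.choose.2 p.2 h.choose_spec)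

/-- Every clopen neighbourhood of a point of the `(b + 1)`-st derivative contains a clopen set that
avoids this point and has exactly one point of the `b`-th derivative. -/
theorem exists_isClopen_inter_eq_singleton {p : X} (hp : p ∈ cbDerivative X (b + 1)) {F : Set X}
    (hF : IsClopen F) (hpF : p ∈ F) :
    ∃ Y ⊆ F, IsClopen Y ∧ p ∉ Y ∧ ∃ y, Y ∩ cbDerivative X b = {y} := by
  have hacc := accPt_iff_frequently.1 (mem_cbDerivative_succ.1 hp)
  have hIic := isClopen_Iic_of_wellFoundedLT p
  obtain ⟨z, ⟨hzp, hz⟩, hzF⟩ := (hacc.and_eventually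
    ((hF.inter hIic).isOpen.mem_nhds ⟨hpF, le_rfl⟩)).exists
  have hne : (F ∩ cbDerivative X b).Nonempty := ⟨z, hzF.1, hz⟩
  have hm := wellFounded_lt.min_mem _ hne
  have hmin : ∀ x ∈ F ∩ cbDerivative X b, wellFounded_lt.min _ hne ≤ x := fun x hx =>
    not_lt.1 (wellFounded_lt.not_lt_min _ hx)
  -- Cut F just after its least rank-b point; the rank-b point z < p of F shows that the cut comes
  -- before p.
  refine ⟨F ∩ Iic (wellFounded_lt.min _ hne), inter_subset_left,
    hF.inter (isClopen_Iic_of_wellFoundedLT _), fun h => ?_, wellFounded_lt.min _ hne, ?_⟩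
  · exact hzp (le_antisymm hzF.2 (le_trans h.2 (hmin z ⟨hzF.1, hz⟩)))
  · ext x
    constructor
    · rintro ⟨⟨hx, hxm⟩, hxD⟩
      exact le_antisymm hxm (hmin x ⟨hx, hxD⟩)
    · rintro rfl
      exact ⟨⟨hm.1, le_rfl⟩, hm.2⟩

variable [CompactSpace X] {π : X → cbDerivative X (b + 1)}

/-- Removing Y from the fibre of p, or adding it to the fibre of q, leaves a single point of the
(b+1)-st derivative in each, so neither homeomorphism type changes. -/
theorem exists_shift [DiscreteTopology (cbDerivative X (b + 1))] (hπ : Continuous π)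
    (hπ' : ∀ p : cbDerivative X (b + 1), π p = p)
    {p q : cbDerivative X (b + 1)} (hpq : p ≠ q) {Y : Set X} (hY : IsClopen Y)
    (hYp : Y ⊆ π ⁻¹' {p}) (hpY : (p : X) ∉ Y) :
    ∃ s : X ≃ₜ X, s '' (π ⁻¹' {p} \ Y) = π ⁻¹' {p} ∧ ∀ x, π x ≠ p → π x ≠ q → s x = x := by
  have hF : ∀ r, IsClopen (π ⁻¹' {r}) := fun r => (isClopen_discrete _).preimage hπ
  have hD := (hF p).union (hF q)
  obtain ⟨e⟩ := nonempty_homeomorph_of_inter_eq_singleton ((hF p).diff hY) (hF p)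
    (fiber_diff_inter_cbDerivative hπ' hpY) (fiber_inter_cbDerivative hπ' p)
  have key : ∀ Y' ⊆ π ⁻¹' {p}, (p : X) ∉ Y' →
      ((π ⁻¹' {p} ∪ π ⁻¹' {q}) \ (π ⁻¹' {p} \ Y')) ∩ cbDerivative X (b + 1) = {(q : X)} := by
    intro Y' hY' hpY'
    ext x
    constructor
    · rintro ⟨⟨hx | hx, hx'⟩, hxP⟩
      · have : x = p := (fiber_inter_cbDerivative hπ' p).subset ⟨hx, hxP⟩
        exact absurd ⟨hx, this ▸ hpY'⟩ hx'
      · exact (fiber_inter_cbDerivative hπ' q).subset ⟨hx, hxP⟩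
    · rintro rfl
      refine ⟨⟨Or.inr (hπ' q), fun h => hpq ?_⟩, q.2⟩
      have h1 : π q = p := h.1
      rw [hπ'] at h1
      exact h1.symm
  obtain ⟨f⟩ := nonempty_homeomorph_of_inter_eq_singleton (hD.diff ((hF p).diff hY))
    (hD.diff ((hF p).diff isClopen_empty)) (key Y hYp hpY) (key ∅ (empty_subset _) (by simp))
  rw [sdiff_empty] at f
  obtain ⟨s, hs, -, hs'⟩ := exists_homeomorph_supported hD ((hF p).diff hY) (hF p)
    (sdiff_subset.trans subset_union_left) subset_union_left e f
  refine ⟨s, ?_, fun x hx hx' => hs' x ?_⟩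
  · ext z
    constructor
    · rintro ⟨x, hx, rfl⟩
      rw [hs ⟨x, hx⟩]
      exact (e _).2
    · intro hz
      refine ⟨e.symm ⟨z, hz⟩, (e.symm ⟨z, hz⟩).2, ?_⟩
      rw [hs, e.apply_symm_apply]
  · rintro (h | h)
    · exact hx h
    · exact hx' h

theorem exists_homeomorph_swap [DiscreteTopology (cbDerivative X (b + 1))] (hπ : Continuous π)
    (hπ' : ∀ p : cbDerivative X (b + 1), π p = p) [DecidableEq (cbDerivative X (b + 1))]
    (p q : cbDerivative X (b + 1)) :
    ∃ t : X ≃ₜ X, ∀ r : cbDerivative X (b + 1), t r = Equiv.swap p q r := by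
  by_cases hpq : p = q
  · subst hpq
    exact ⟨1, fun r => by simp⟩
  have hF : ∀ r, IsClopen (π ⁻¹' {r}) := fun r => (isClopen_discrete _).preimage hπ
  have hdis : Disjoint (π ⁻¹' {p}) (π ⁻¹' {q}) := Disjoint.preimage _ (by simpa using hpq)
  obtain ⟨e⟩ := nonempty_homeomorph_of_inter_eq_singleton (hF p) (hF q)
    (fiber_inter_cbDerivative hπ' p) (fiber_inter_cbDerivative hπ' q)
  obtain ⟨t, ht, ht', ht''⟩ := exists_homeomorph_supported ((hF p).union (hF q)) (hF p) (hF q)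
    subset_union_left subset_union_right e
    (((Homeomorph.setCongr hdis.sup_sdiff_cancel_left).trans e.symm).trans
      (Homeomorph.setCongr hdis.sup_sdiff_cancel_right).symm)
  have hmem : ∀ r : cbDerivative X (b + 1), t r ∈ cbDerivative X (b + 1) := fun r =>
    (t.apply_mem_cbDerivative _ _).2 r.2
  refine ⟨t, fun r => ?_⟩
  by_cases hrp : r = p
  · subst hrp
    rw [Equiv.swap_apply_left]
    refine (fiber_inter_cbDerivative hπ' q).subset ⟨?_, hmem r⟩
    rw [ht ⟨r, hπ' r⟩]
    exact (e _).2
  by_cases hrq : r = q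
  · subst hrq
    rw [Equiv.swap_apply_right]
    refine (fiber_inter_cbDerivative hπ' p).subset ⟨?_, hmem r⟩
    rw [ht' ⟨r, Or.inr (hπ' r), fun h => hrp ((hπ' r).symm.trans h)⟩]
    exact (e.symm _).2
  rw [Equiv.swap_apply_of_ne_of_ne hrp hrq]
  refine ht'' _ ?_
  simp [hπ', hrp, hrq]

theorem sbGenerated_of_finite (hfin : (cbDerivative X (b + 1)).Finite)
    (hne : (cbDerivative X (b + 1)).Nonempty) : SBGenerated (X ≃ₜ X) := by
  classical
  have := hfin.to_subtype
  obtain ⟨π, hπ, hπ'⟩ := exists_retraction_of_finite hfin hne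
  have hF : ∀ r, IsClopen (π ⁻¹' {r}) := fun r => (isClopen_discrete _).preimage hπ
  let p₀ : cbDerivative X (b + 1) := ⟨_, hne.some_mem⟩
  choose Y hYp hY hpY y hy using fun p : cbDerivative X (b + 1) =>
    exists_isClopen_inter_eq_singleton p.2 (hF p) (hπ' p)
  have hshift : ∀ p, ∃ s : X ≃ₜ X, p ≠ p₀ → s '' (π ⁻¹' {p} \ Y p) = π ⁻¹' {p} ∧
      ∀ x, π x ≠ p → π x ≠ p₀ → s x = x := by
    intro p
    by_cases hp : p = p₀
    · exact ⟨1, fun h => absurd hp h⟩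
    · obtain ⟨s, hs⟩ := exists_shift hπ hπ' hp (hY p) (hYp p) (hpY p)
      exact ⟨s, fun _ => hs⟩
  choose s hs using hshift
  choose t ht using exists_homeomorph_swap hπ hπ'
  let S : Set (X ≃ₜ X) := (⋃ p, (supportedIn (π ⁻¹' {p}) : Set (X ≃ₜ X))) ∪
    (range s ∪ range fun z : cbDerivative X (b + 1) × cbDerivative X (b + 1) => t z.1 z.2)
  have hsupp : ∀ p, supportedIn (π ⁻¹' {p}) ≤ Subgroup.closure S := fun p g hg =>
    Subgroup.subset_closure (Or.inl (mem_iUnion.2 ⟨p, hg⟩))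
  have hsS : ∀ p, s p ∈ Subgroup.closure S := fun p =>
    Subgroup.subset_closure (Or.inr (Or.inl ⟨p, rfl⟩))
  have htS : ∀ p q, t p q ∈ Subgroup.closure S := fun p q =>
    Subgroup.subset_closure (Or.inr (Or.inr ⟨(p, q), rfl⟩))
  refine ⟨S, LengthBounded.stronglyBounded ?_, ?_⟩
  · refine (LengthBounded.iUnion fun p => ?_).union
      ((finite_range s).lengthBounded.union (finite_range _).lengthBounded)
    exact lengthBounded_supportedIn (hF p) (fiber_inter_cbDerivative hπ' p)
  · have hperm : ∀ σ : Equiv.Perm (cbDerivative X (b + 1)), ∃ k ∈ Subgroup.closure S,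
        ∀ r : cbDerivative X (b + 1), k r = σ r := by
      intro σ
      induction σ using Equiv.Perm.swap_induction_on with
      | one => exact ⟨1, one_mem _, fun r => rfl⟩
      | swap_mul σ p q _ ih =>
        obtain ⟨k, hk, hk'⟩ := ih
        refine ⟨t p q * k, mul_mem (htS p q) hk, fun r => ?_⟩
        rw [Homeomorph.mul_apply, hk', ht, Equiv.Perm.mul_apply]
    refine eq_top_iff.2 fun g _ => ?_
    let σ : Equiv.Perm (cbDerivative X (b + 1)) :=
      g.toEquiv.subtypeEquiv fun x => (g.apply_mem_cbDerivative _ x).symm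
    obtain ⟨k, hk, hkσ⟩ := hperm σ
    have h1 : k⁻¹ * g ∈ Subgroup.closure S := by
      refine mem_of_fixes_cbDerivative (p₀ := p₀) hπ hπ' hsupp hY hYp hpY hy hsS
        (fun p hp => (hs p hp).1) (fun p hp => (hs p hp).2) fun p => ?_
      have h2 : k p = g p := hkσ p
      rw [Homeomorph.mul_apply, ← h2]
      exact k.symm_apply_apply _
    simpa using mul_mem hk h1

end

/-- A non-successor rank would be its own `Ordinal.pred`, hence could not equal b + 1. -/
theorem cantorBendixsonRank_eq_of_limitCapacity_eq {X : Type u} [TopologicalSpace X]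
    {b : Ordinal.{u}} (h : limitCapacity X = b + 1) : cantorBendixsonRank X = b + 1 + 1 := by
  unfold limitCapacity at h
  by_cases hs : Order.IsSuccPrelimit (cantorBendixsonRank X)
  · rw [Ordinal.pred_eq_of_isSuccPrelimit hs] at h
    rw [h] at hs
    exact absurd hs (Order.not_isSuccPrelimit_succ b)
  · rw [← Ordinal.succ_pred_eq_iff_not_isSuccPrelimit.2 hs, h]
    rfl

/-- If the limit capacity of a compact well-ordered space `X` (a well-ordered set with its order
topology) is a successor ordinal, then the group of all self-homeomorphisms of `X` is
SB-generated. -/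
theorem mainTheorem3 (X : Type*) [LinearOrder X] [WellFoundedLT X] [TopologicalSpace X]
    [OrderTopology X] [CompactSpace X] (hX : ∃ a : Ordinal, limitCapacity X = a + 1) :
    SBGenerated (X ≃ₜ X) := by
  obtain ⟨b, hb⟩ := hX
  have hrank := cantorBendixsonRank_eq_of_limitCapacity_eq hb
  -- Stabilisation is read off from the rank: an empty set of stages would give the infimum 0, which
  -- is not b + 2.
  have hset : {a | cbDerivative X (a + 1) = cbDerivative X a}.Nonempty := by
    by_contra h
    have : cantorBendixsonRank X = 0 := by
      change sInf {a | cbDerivative X (a + 1) = cbDerivative X a} = 0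
      rw [not_nonempty_iff_eq_empty.1 h, Ordinal.sInf_empty]
    rw [this] at hrank
    exact (Order.succ_ne_bot (b + 1)) hrank.symm
  have hmem : cbDerivative X (b + 1 + 1 + 1) = cbDerivative X (b + 1 + 1) := by
    have := csInf_mem hset
    rwa [show sInf {a | cbDerivative X (a + 1) = cbDerivative X a} = b + 1 + 1 from hrank] at this
  -- The stable derivative is dense in itself, which the well-order forbids unless it is empty.
  have hempty : cbDerivative X (b + 1 + 1) = ∅ :=
    eq_empty_of_subset_derivedSet fun x hx => by
      rw [← hmem] at hx
      exact mem_cbDerivative_succ.1 hx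
  have hfin : (cbDerivative X (b + 1)).Finite := by
    have := finite_cbDerivative_inter_of_isCompact (X := X) (a := b + 1) isCompact_univ
      (by rw [hempty]; exact disjoint_bot_right)
    rwa [inter_univ] at this
  refine sbGenerated_of_finite hfin (nonempty_iff_ne_empty.2 fun h => ?_)
  have h1 : b + 1 ∈ {a | cbDerivative X (a + 1) = cbDerivative X a} := by
    change cbDerivative X (b + 1 + 1) = cbDerivative X (b + 1)
    rw [hempty, h]
  have h2 : cantorBendixsonRank X ≤ b + 1 := csInf_le' h1
  rw [hrank] at h2
  exact absurd h2 (not_le.2 (Order.lt_succ (b + 1)))
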